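/- Let $Q\in L^1_{\mathrm{loc}}]0,\infty[$ be complex valued, let $m,k\in\mathbb C$ with $\Re(m)\ge 0$, $m\neq 0$, $\Re(k)\ge 0$, let $\varepsilon\ge 0$ and suppose that $\int_0^1 x^{1-\varepsilon}|Q(x)|\,dx<\infty$ (that is, $Q\in\mathscr L^{(0)}_\varepsilon$). Let $n$ be a nonnegative integer with $\frac{\varepsilon}{2}(n+1)\ge\Re(m)$. Consider the equation $$-f''(x)+\Big(\big(m^2-\tfrac14\big)\tfrac1{x^2}+Q(x)\Big)f(x)=-k^2f(x)\qquad\text{for a.e. } x\in\,]0,\infty[, \tag{1}$$ for $f\in AC^1]0,\infty[$ (differentiable, with locally absolutely continuous derivative). For $x>0$ put $u^0_{\mu}(x,k)=x^{\frac12+\mu}\sum_{j\ge0}\frac{(k^2x^2/4)^j}{j!\,\Gamma(\mu+j+1)}$ for $\mu\in\mathbb C$ (equal to $(2/k)^{\mu}\sqrt x\,I_{\mu}(kx)$ if $k\ne0$), and $v^0_m(x,k)=(k/2)^m\sqrt x\,K_m(kx)$ if $k\neq0$, $v^0_m(x,0)=\frac12\Gamma(m)x^{\frac12-m}$, where $I_\mu$,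 $K_m$ are the modified Bessel and Macdonald functions. Let $G^{0(1)}_{\bowtie}=G^{0(1)}_{\bowtie}(-k^2)$ and $G^0_\to$ be the integral operators on functions on $]0,\infty[$ with kernels $$G^{0(1)}_{\bowtie}(x,y)=\begin{cases} v^0_m(x,k)u^0_m(y,k), & y\le x\le 1,\\ u^0_m(x,k)v^0_m(y,k), & x<y\le 1,\\ 0,&\text{otherwise,}\end{cases}\qquad G^0_\to(x,y)=\begin{cases} v^0_m(x,k)u^0_m(y,k)-u^0_m(x,k)v^0_m(y,k), & y\le x,\\ 0,&y>x,\end{cases}$$ and set $$u^{0[n]}_{-m}(x,k)=\sum_{j=0}^n\big(-G^{0(1)}_{\bowtie}(-k^2)Q\big)^ju^0_{-m}(x,k).$$ (a) The functions $(G^{0(1)}_{\bowtie}Q)^ju^0_{-m}(\cdot,k)$, $j\ge0$, on $]0,\infty[$ and $G^0_\to Q(G^{0(1)}_{\bowtie}Q)^nu^0_{-m}(\cdot,k)$ on $]0,1[$ are given by absolutely convergent integrals, and $u^{0[n]}_{-m}(\cdot,k)$ is differentiable on $]0,1[$. There is a unique solution $u^{[n]}_{-m}(\cdot,k)\in AC^1]0,\infty[$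 of (1) such that, as $x\to0$, $$u^{[n]}_{-m}(x,k)-u^{0[n]}_{-m}(x,k)=o\big(x^{\frac12+\Re(m)}\big),\qquad \partial_xu^{[n]}_{-m}(x,k)-\partial_xu^{0[n]}_{-m}(x,k)=o\big(x^{-\frac12+\Re(m)}\big).$$ On $]0,1[$ it is given by $$u^{[n]}_{-m}(\cdot,k)=u^{0[n]}_{-m}(\cdot,k)+(-1)^{n+1}\big(1+G^0_\to Q\big)^{-1}G^0_\to Q\big(G^{0(1)}_{\bowtie}Q\big)^nu^0_{-m}(\cdot,k),$$ where $r=(1+G^0_\to Q)^{-1}F$ denotes the unique solution of $r+G^0_\to Qr=F$ on $]0,1[$ among the measurable functions with $x^{-\frac12-\Re(m)}r\in L^\infty]0,1[$. (b) If moreover $\Re(m)<1$, then for every $k'\in\mathbb C$ with $\Re(k')\ge0$, in particular for $k'=0$, there is a unique solution $g\in AC^1]0,\infty[$ of (1) (with the parameter $k$) such that, as $x\to0$, $$g(x)-u^{0[n]}_{-m}(x,k')=o\big(x^{\frac12+\Re(m)}\big),\qquad \partial_xg(x)-\partial_xu^{0[n]}_{-m}(x,k')=o\big(x^{-\frac12+\Re(m)}\big).$$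 -/

import Mathlib

open MeasureTheory Set Filter Topology Asymptotics

noncomputable section

namespace PerturbedBessel

/-- The normalized hypergeometric function `𝐅_m(w) = ∑ₙ wⁿ / (n! Γ(m+n+1))`. The summand is `0`
when `m + n + 1` is a pole of `Γ` (there `Complex.Gamma` is `0` and so is its inverse), as it should
be for the entire function `1/Γ`. -/
def hypF (m w : ℂ) : ℂ :=
  ∑' n : ℕ, w ^ n * ((n.factorial : ℂ) * Complex.Gamma (m + n + 1))⁻¹

/-- The unperturbed solution `u⁰_m(x,k) = x^{1/2+m} 𝐅_m(k²x²/4)`, that is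
`(2/k)^m √x I_m(kx)` for `k ≠ 0` and `x^{1/2+m}/Γ(m+1)` for `k = 0`. -/
def u0 (m k : ℂ) (x : ℝ) : ℂ :=
  (x : ℂ) ^ (1 / 2 + m) * hypF m (k ^ 2 * (x : ℂ) ^ 2 / 4)

/-- The function `(k/2)^m √x K_m(kx)` for `k ≠ 0` and `m ∉ ℤ`, with the Macdonald function
`K_m = π (I_{-m} - I_m) / (2 sin(π m))`. -/
def v0NonInt (m k : ℂ) (x : ℝ) : ℂ :=
  (Real.pi : ℂ) / (2 * Complex.sin (Real.pi * m)) *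
    (u0 (-m) k x - (k / 2) ^ (2 * m) * u0 m k x)

open Classical in
/-- The unperturbed solution `v⁰_m(x,k)`: it is `(k/2)^m √x K_m(kx)` for `k ≠ 0`, where for an
integer `m` the Macdonald function is the limit of the formula for non-integer orders, and
`Γ(m) x^{1/2-m} / 2` for `k = 0`. -/
def v0 (m k : ℂ) (x : ℝ) : ℂ :=
  if k = 0 then Complex.Gamma m * (x : ℂ) ^ (1 / 2 - m) / 2
  else if ∃ N : ℤ, m = N then limUnder (𝓝[≠] m) (fun μ : ℂ => v0NonInt μ k x)
  else v0NonInt m k x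

/-- The kernel of the two-sided Green operator of the unperturbed Bessel operator plus `k²`. -/
def twoSidedKernel (m k : ℂ) (x y : ℝ) : ℂ :=
  if y ≤ x then v0 m k x * u0 m k y else u0 m k x * v0 m k y

/-- The two-sided kernel compressed to `]0,a[`. -/
def twoSidedKernelOn (a : ℝ) (m k : ℂ) (x y : ℝ) : ℂ :=
  if x ≤ a ∧ y ≤ a then twoSidedKernel m k x y else 0

/-- The kernel of the forward Green operator of the unperturbed Bessel operator plus `k²`. -/
def forwardKernel (m k : ℂ) (x y : ℝ) : ℂ :=
  if y ≤ x then v0 m k x * u0 m k y - u0 m k x * v0 m k y else 0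

/-- The operator `f ↦ G(Q f)` on functions on `]0,∞[`, for a kernel `G`. -/
def greenQ (G : ℝ → ℝ → ℂ) (Q f : ℝ → ℂ) : ℝ → ℂ :=
  fun x => ∫ y in Ioi (0 : ℝ), G x y * (Q y * f y)

/-- The integral defining `(G(Q f))(x)` converges absolutely. -/
def GreenQDefinedAt (G : ℝ → ℝ → ℂ) (Q f : ℝ → ℂ) (x : ℝ) : Prop :=
  IntegrableOn (fun y => G x y * (Q y * f y)) (Ioi (0 : ℝ))

/-- The `j`-th iterate `(G Q)^j u⁰_{-m}(·,k)` with the two-sided kernel compressed to `]0,1[`. -/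
def iter (m k : ℂ) (Q : ℝ → ℂ) (j : ℕ) : ℝ → ℂ :=
  (greenQ (twoSidedKernelOn 1 m k) Q)^[j] (u0 (-m) k)

/-- The truncated series `u^{0[n]}_{-m}(x,k) = ∑_{j ≤ n} (-G Q)^j u⁰_{-m}(x,k)`. -/
def trunc (m k : ℂ) (Q : ℝ → ℂ) (n : ℕ) : ℝ → ℂ :=
  fun x => ∑ j ∈ Finset.range (n + 1),
    ((fun f : ℝ → ℂ => -greenQ (twoSidedKernelOn 1 m k) Q f)^[j] (u0 (-m) k)) x

/-- The class `𝓛^{(0)}_ε`: `Q ∈ L¹_loc ]0,∞[` with `∫₀¹ x^{1-ε} |Q(x)| dx < ∞`. -/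
def PotentialClass (ε : ℝ) : Set (ℝ → ℂ) :=
  {Q | LocallyIntegrableOn Q (Ioi (0 : ℝ)) ∧
    IntegrableOn (fun x : ℝ => x ^ (1 - ε) * ‖Q x‖) (Ioo (0 : ℝ) 1)}

/-- `f ∈ AC¹]0,∞[`: `f` is differentiable on `]0,∞[` and its derivative is absolutely continuous
on every compact subinterval. -/
def IsAC1 (f : ℝ → ℂ) : Prop :=
  (∀ x : ℝ, 0 < x → DifferentiableAt ℝ f x) ∧
    ∀ a b : ℝ, 0 < a → a ≤ b → AbsolutelyContinuousOnInterval (deriv f) a b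

/-- `f ∈ AC¹]0,∞[` solves `-f'' + ((m² - 1/4)/x² + Q) f = -k² f` almost everywhere. -/
def IsEigensolution (m k : ℂ) (Q f : ℝ → ℂ) : Prop :=
  IsAC1 f ∧ ∀ᵐ x : ℝ, 0 < x →
    -deriv (deriv f) x + ((m ^ 2 - 1 / 4) / (x : ℂ) ^ 2 + Q x) * f x = -k ^ 2 * f x

/-- `f - h = o(x^{1/2+Re m})` and `f' - h' = o(x^{-1/2+Re m})` as `x → 0+`. -/
def AgreesNearZero (m : ℂ) (f h : ℝ → ℂ) : Prop :=
  ((fun x => f x - h x) =o[𝓝[>] (0 : ℝ)] fun x : ℝ => x ^ (1 / 2 + m.re)) ∧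
  ((fun x => deriv f x - deriv h x) =o[𝓝[>] (0 : ℝ)] fun x : ℝ => x ^ (-1 / 2 + m.re))

/-- `r = (1 + G_→ Q)^{-1} F` in the weighted space `L^∞(]0,1[, x^{1/2+Re m})`. -/
def IsForwardResolvent (m k : ℂ) (Q F r : ℝ → ℂ) : Prop :=
  AEStronglyMeasurable r (volume.restrict (Ioo (0 : ℝ) 1)) ∧
  (∃ C : ℝ, ∀ᵐ x ∂volume.restrict (Ioo (0 : ℝ) 1), ‖r x‖ ≤ C * x ^ (1 / 2 + m.re)) ∧
  ∀ x ∈ Ioo (0 : ℝ) 1, r x + greenQ (forwardKernel m k) Q r x = F x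

end PerturbedBessel

end

/-!
On `]0,∞[` the unperturbed equation has the fundamental system `u⁰_m`, `v⁰_m` of sizes
`x^{1/2+Re m}` and `x^{1/2-Re m}`, so for every inhomogeneity the two Green operators are
variation of parameters with different choices of the integration limits. A weight `x^{1-ε}` in
the integrability of `Q` makes each application of `G_⋈ Q` gain a factor `x^ε` over
`u⁰_{-m} = O(x^{1/2-Re m})`, until the size `x^{1/2+Re m}` is reached. The truncated series
therefore solves the perturbed equation up to the defect `± Q (G_⋈ Q)ⁿ u⁰_{-m}`, which, once
`(n+1) ε ≥ 2 Re m`, is small enough for the forward Green operator. The correction solves the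
Volterra equation `r + G_→ Q r = G_→ (defect)`, whose Neumann series converges, and uniqueness is
Volterra uniqueness for the homogeneous equation. When the series is built from another `k'`, the
defect gains the term `(k'² - k²) u^{0[n]}_{-m}`, which is admissible exactly because `Re m < 1`.
-/

namespace PerturbedBessel

section AbsoluteContinuity

variable {X Y : Type*} [PseudoMetricSpace X] [PseudoMetricSpace Y]
  {E : Type*} [NormedAddCommGroup E] [NormedSpace ℝ E] {a b : ℝ}

theorem absolutelyContinuousOnInterval_of_dist_le {f : ℝ → X} {g : ℝ → Y}
    (hg : AbsolutelyContinuousOnInterval g a b)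
    (h : ∀ x ∈ uIcc a b, ∀ y ∈ uIcc a b, dist (f x) (f y) ≤ dist (g x) (g y)) :
    AbsolutelyContinuousOnInterval f a b := by
  refine squeeze_zero' (.of_forall fun E => Finset.sum_nonneg fun i _ => dist_nonneg) ?_ hg
  filter_upwards [mem_inf_of_right (mem_principal_self _)] with E hE
  exact Finset.sum_le_sum fun i hi => h _ (hE.1 i hi).1 _ (hE.1 i hi).2

theorem absolutelyContinuousOnInterval_congr {f g : ℝ → X}
    (hf : AbsolutelyContinuousOnInterval f a b) (h : EqOn f g (uIcc a b)) :
    AbsolutelyContinuousOnInterval g a b :=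
  absolutelyContinuousOnInterval_of_dist_le hf fun x hx y hy => by rw [h hx, h hy]

theorem absolutelyContinuousOnInterval_integral {f : ℝ → E}
    (hf : IntervalIntegrable f volume a b) :
    AbsolutelyContinuousOnInterval (fun x => ∫ t in a..x, f t) a b := by
  refine absolutelyContinuousOnInterval_of_dist_le
    (hf.norm.absolutelyContinuousOnInterval_intervalIntegral left_mem_uIcc) fun x hx y hy => ?_
  have hx' : IntervalIntegrable f volume a x := hf.mono_set (uIcc_subset_uIcc left_mem_uIcc hx)
  have hy' : IntervalIntegrable f volume a y := hf.mono_set (uIcc_subset_uIcc left_mem_uIcc hy)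
  rw [dist_eq_norm, Real.dist_eq, intervalIntegral.integral_interval_sub_left hx' hy',
    intervalIntegral.integral_interval_sub_left hx'.norm hy'.norm]
  exact intervalIntegral.norm_integral_le_abs_integral_norm

theorem integral_eq_sub_of_absolutelyContinuousOnInterval [CompleteSpace E] {f f' : ℝ → E}
    (hf : AbsolutelyContinuousOnInterval f a b) (hf' : IntervalIntegrable f' volume a b)
    (h : ∀ᵐ x, x ∈ uIcc a b → HasDerivAt f (f' x) x) :
    ∫ x in a..b, f' x = f b - f a := by
  obtain ⟨C, hC⟩ := (hf.sub
    (absolutelyContinuousOnInterval_integral hf')).const_of_ae_hasDerivAt_zero (by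
      filter_upwards [h, hf'.ae_hasDerivAt_integral] with x h1 h2 hx
      simpa using (h1 hx).sub (h2 hx a left_mem_uIcc))
  have hb := hC b right_mem_uIcc
  have ha := hC a left_mem_uIcc
  simp only [Pi.sub_apply, intervalIntegral.integral_same, sub_zero] at ha hb
  rw [ha, ← hb, sub_sub_cancel]

end AbsoluteContinuity

section HalfLine

variable {E : Type*} [NormedAddCommGroup E]

theorem uIcc_subset_Ioi {a b : ℝ} (ha : 0 < a) (hb : 0 < b) : uIcc a b ⊆ Ioi 0 :=
  fun _ hx => (lt_min ha hb).trans_le hx.1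

theorem intervalIntegrable_of_locallyIntegrableOn {f : ℝ → E}
    (hf : LocallyIntegrableOn f (Ioi 0)) {a b : ℝ} (ha : 0 < a) (hb : 0 < b) :
    IntervalIntegrable f volume a b :=
  (hf.integrableOn_compact_subset (uIcc_subset_Ioi ha hb) isCompact_uIcc).intervalIntegrable

theorem locallyIntegrableOn_of_integrableOn_Ioc {f : ℝ → E}
    (hf : ∀ X : ℝ, IntegrableOn f (Ioc 0 X)) : LocallyIntegrableOn f (Ioi 0) := by
  refine (locallyIntegrableOn_iff isOpen_Ioi.isLocallyClosed).2 fun K hK hKc => ?_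
  obtain ⟨X, hX⟩ := hKc.bddAbove
  exact (hf X).mono_set fun y hy => ⟨hK hy, hX hy⟩

theorem continuousOn_Ioi_of_continuousOn_uIcc {X : Type*} [TopologicalSpace X] {f : ℝ → X}
    (hf : ∀ a b : ℝ, 0 < a → a ≤ b → ContinuousOn f (uIcc a b)) : ContinuousOn f (Ioi 0) := by
  intro x (hx : 0 < x)
  refine ((hf (x / 2) (2 * x) (half_pos hx) (by linarith)).continuousAt ?_).continuousWithinAt
  rw [uIcc_of_le (by linarith)]
  exact Icc_mem_nhds (by linarith) (by linarith)

theorem ae_pos_of_forall_Icc {p : ℝ → Prop}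
    (h : ∀ a b : ℝ, 0 < a → a ≤ b → ∀ᵐ x : ℝ, x ∈ Icc a b → p x) : ∀ᵐ x : ℝ, 0 < x → p x := by
  have hcover : ∀ᵐ x : ℝ, ∀ n : ℕ, x ∈ Icc (1 / ((n : ℝ) + 1)) ((n : ℝ) + 1) → p x :=
    ae_all_iff.2 fun n => h _ _ (by positivity) <| by
      rw [div_le_iff₀ (by positivity)]
      nlinarith [(Nat.cast_nonneg n : (0 : ℝ) ≤ n)]
  filter_upwards [hcover] with x hx hx0
  obtain ⟨n, hn⟩ := exists_nat_gt (max x (1 / x))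
  have hxn : 1 / x < n := (le_max_right _ _).trans_lt hn
  refine hx n ⟨?_, by linarith [le_max_left x (1 / x)]⟩
  rw [div_lt_iff₀ hx0] at hxn
  rw [div_le_iff₀ (by positivity)]
  nlinarith

theorem tendsto_integral_zero [NormedSpace ℝ E] {q : ℝ → E} {X : ℝ} (hX : 0 < X)
    (hq : IntegrableOn q (Ioc 0 X)) :
    Tendsto (fun x : ℝ => ∫ y in (0 : ℝ)..x, q y) (𝓝[>] 0) (𝓝 0) := by
  have hcont := intervalIntegral.continuousOn_primitive_interval (f := q) (μ := volume)
    (a := 0) (b := X) (by rwa [uIcc_of_le hX.le, integrableOn_Icc_iff_integrableOn_Ioc])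
  have h0 := hcont 0 left_mem_uIcc
  rw [ContinuousWithinAt, intervalIntegral.integral_same, uIcc_of_le hX.le] at h0
  exact h0.mono_left (nhdsWithin_le_of_mem
    (mem_of_superset (Ioc_mem_nhdsGT hX) Ioc_subset_Icc_self))

end HalfLine

/-- `F` is a primitive of the locally integrable function `f` on `]0,∞[`. This is how equations
between functions with absolutely continuous derivative are expressed below: unlike a statement
about derivatives almost everywhere, it is an identity that integrates by parts. -/
structure IsLocalPrimitive {E : Type*} [NormedAddCommGroup E] [NormedSpace ℝ E]
    (f F : ℝ → E) : Prop where
  locallyIntegrableOn : LocallyIntegrableOn f (Ioi 0)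
  integral_eq : ∀ a b : ℝ, 0 < a → 0 < b → ∫ x in a..b, f x = F b - F a

namespace IsLocalPrimitive

section NormedSpace

variable {E : Type*} [NormedAddCommGroup E] [NormedSpace ℝ E] {f F g G : ℝ → E}

theorem intervalIntegrable (h : IsLocalPrimitive f F) {a b : ℝ} (ha : 0 < a) (hb : 0 < b) :
    IntervalIntegrable f volume a b :=
  intervalIntegrable_of_locallyIntegrableOn h.locallyIntegrableOn ha hb

theorem eq_add_integral (h : IsLocalPrimitive f F) {a x : ℝ} (ha : 0 < a) (hx : 0 < x) :
    F x = F a + ∫ t in a..x, f t := by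
  rw [h.integral_eq a x ha hx, add_sub_cancel]

theorem absolutelyContinuousOnInterval (h : IsLocalPrimitive f F) {a b : ℝ} (ha : 0 < a)
    (hb : 0 < b) : AbsolutelyContinuousOnInterval F a b := by
  refine absolutelyContinuousOnInterval_of_dist_le
    (absolutelyContinuousOnInterval_integral (h.intervalIntegrable ha hb)) fun x hx y hy => ?_
  rw [h.eq_add_integral ha (uIcc_subset_Ioi ha hb hx),
    h.eq_add_integral ha (uIcc_subset_Ioi ha hb hy), dist_add_left]

theorem continuousOn (h : IsLocalPrimitive f F) : ContinuousOn F (Ioi 0) :=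
  continuousOn_Ioi_of_continuousOn_uIcc fun _ _ ha hab =>
    (h.absolutelyContinuousOnInterval ha (ha.trans_le hab)).continuousOn

theorem ae_hasDerivAt [CompleteSpace E] (h : IsLocalPrimitive f F) :
    ∀ᵐ x : ℝ, 0 < x → HasDerivAt F (f x) x := by
  refine ae_pos_of_forall_Icc fun a b ha hab => ?_
  filter_upwards [(h.intervalIntegrable ha (ha.trans_le hab)).ae_hasDerivAt_integral]
    with x hx hxab
  have hderiv := (hx (by rwa [uIcc_of_le hab]) a left_mem_uIcc).const_add (F a)
  refine hderiv.congr_of_eventuallyEq ?_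
  filter_upwards [Ioi_mem_nhds (ha.trans_le hxab.1)] with y hy
  exact h.eq_add_integral ha hy

theorem of_ae_hasDerivAt [CompleteSpace E] (hf : LocallyIntegrableOn f (Ioi 0))
    (hF : ∀ a b : ℝ, 0 < a → a ≤ b → AbsolutelyContinuousOnInterval F a b)
    (h : ∀ᵐ x : ℝ, 0 < x → HasDerivAt F (f x) x) : IsLocalPrimitive f F := by
  refine ⟨hf, fun a b ha hb => integral_eq_sub_of_absolutelyContinuousOnInterval ?_
    (intervalIntegrable_of_locallyIntegrableOn hf ha hb) ?_⟩
  · rcases le_total a b with hab | hab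
    · exact hF a b ha hab
    · exact (hF b a hb hab).symm
  · filter_upwards [h] with x hx hxab
    exact hx (uIcc_subset_Ioi ha hb hxab)

theorem hasDerivAt [CompleteSpace E] (h : IsLocalPrimitive f F) (hf : ContinuousOn f (Ioi 0))
    {x : ℝ} (hx : 0 < x) : HasDerivAt F (f x) x := by
  have hderiv : HasDerivAt (fun y => F x + ∫ t in x..y, f t) (f x) x :=
    (intervalIntegral.integral_hasDerivAt_right .refl
      (hf.stronglyMeasurableAtFilter isOpen_Ioi x hx)
      (hf.continuousAt (Ioi_mem_nhds hx))).const_add _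
  refine hderiv.congr_of_eventuallyEq ?_
  filter_upwards [Ioi_mem_nhds hx] with y hy
  exact h.eq_add_integral hx hy

theorem of_hasDerivAt [CompleteSpace E] (hF : ∀ x : ℝ, 0 < x → HasDerivAt F (f x) x)
    (hf : ContinuousOn f (Ioi 0)) : IsLocalPrimitive f F where
  locallyIntegrableOn := hf.locallyIntegrableOn measurableSet_Ioi
  integral_eq _ _ ha hb := intervalIntegral.integral_eq_sub_of_hasDerivAt
    (fun x hx => hF x (uIcc_subset_Ioi ha hb hx))
    (hf.mono (uIcc_subset_Ioi ha hb)).intervalIntegrable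

theorem of_integrableOn_Ioc (hf : ∀ X : ℝ, IntegrableOn f (Ioc 0 X)) :
    IsLocalPrimitive f (fun x => ∫ y in (0 : ℝ)..x, f y) where
  locallyIntegrableOn := locallyIntegrableOn_of_integrableOn_Ioc hf
  integral_eq a b ha hb := by
    have hint : ∀ X : ℝ, 0 < X → IntervalIntegrable f volume 0 X := fun X hX =>
      (intervalIntegrable_iff_integrableOn_Ioc_of_le hX.le).2 (hf X)
    exact (intervalIntegral.integral_interval_sub_left (hint b hb) (hint a ha)).symm

theorem eq_integral_of_tendsto (h : IsLocalPrimitive f F)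
    (hf : ∀ X : ℝ, IntegrableOn f (Ioc 0 X)) (hF : Tendsto F (𝓝[>] 0) (𝓝 0)) {x : ℝ}
    (hx : 0 < x) : F x = ∫ y in (0 : ℝ)..x, f y := by
  have hlim : Tendsto (fun s => F s + ((∫ y in (0 : ℝ)..x, f y) - ∫ y in (0 : ℝ)..s, f y))
      (𝓝[>] 0) (𝓝 (0 + ((∫ y in (0 : ℝ)..x, f y) - 0))) :=
    hF.add ((tendsto_integral_zero one_pos (hf 1)).const_sub _)
  have hconst : (fun _ => F x) =ᶠ[𝓝[>] 0]
      fun s => F s + ((∫ y in (0 : ℝ)..x, f y) - ∫ y in (0 : ℝ)..s, f y) := by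
    filter_upwards [self_mem_nhdsWithin] with s hs
    rw [← (of_integrableOn_Ioc hf).integral_eq s x hs hx, ← h.eq_add_integral hs hx]
  simpa using tendsto_nhds_unique (tendsto_const_nhds.congr' hconst) hlim

theorem congr (h : IsLocalPrimitive f F) (hf : EqOn f g (Ioi 0)) (hF : EqOn F G (Ioi 0)) :
    IsLocalPrimitive g G where
  locallyIntegrableOn :=
    h.locallyIntegrableOn.congr (ae_restrict_of_forall_mem measurableSet_Ioi hf)
  integral_eq a b ha hb := by
    rw [← hF ha, ← hF hb, ← h.integral_eq a b ha hb]
    exact intervalIntegral.integral_congr fun x hx => (hf (uIcc_subset_Ioi ha hb hx)).symm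

theorem add (h : IsLocalPrimitive f F) (h' : IsLocalPrimitive g G) :
    IsLocalPrimitive (fun x => f x + g x) (fun x => F x + G x) where
  locallyIntegrableOn := h.locallyIntegrableOn.add h'.locallyIntegrableOn
  integral_eq a b ha hb := by
    rw [intervalIntegral.integral_add (h.intervalIntegrable ha hb) (h'.intervalIntegrable ha hb),
      h.integral_eq a b ha hb, h'.integral_eq a b ha hb, add_sub_add_comm]

end NormedSpace

section NormedAlgebra

variable {A : Type*} [NormedRing A] [NormMulClass A] [NormedAlgebra ℝ A] {f F g G : ℝ → A}

theorem mul [CompleteSpace A] (h : IsLocalPrimitive f F) (h' : IsLocalPrimitive g G) :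
    IsLocalPrimitive (fun x => f x * G x + F x * g x) (fun x => F x * G x) := by
  refine of_ae_hasDerivAt ?_ ?_ ?_
  · exact (h.locallyIntegrableOn.mul_continuousOn h'.continuousOn
      isOpen_Ioi.isLocallyClosed).add
      (h'.locallyIntegrableOn.continuousOn_mul h.continuousOn isOpen_Ioi.isLocallyClosed)
  · intro a b ha hab
    exact (h.absolutelyContinuousOnInterval ha (ha.trans_le hab)).fun_smul
      (h'.absolutelyContinuousOnInterval ha (ha.trans_le hab))
  · filter_upwards [h.ae_hasDerivAt, h'.ae_hasDerivAt] with x hF hG hx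
    exact (hF hx).mul (hG hx)

theorem const_mul [CompleteSpace A] (c : A) (h : IsLocalPrimitive f F) :
    IsLocalPrimitive (fun x => c * f x) (fun x => c * F x) :=
  ((of_hasDerivAt (fun x _ => hasDerivAt_const x c) continuousOn_const).mul h).congr
    (fun x _ => by simp) fun _ _ => rfl

end NormedAlgebra

end IsLocalPrimitive

section PotentialClass

variable {p q f : ℝ → ℂ} {ε δ b s : ℝ}

theorem continuousOn_rpow_Ioi (s : ℝ) : ContinuousOn (fun y : ℝ => y ^ s) (Ioi 0) :=
  continuousOn_id.rpow_const fun _ hy => Or.inl (ne_of_gt hy)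

theorem exists_norm_le_rpow_of_isBigO {E : Type*} [NormedAddCommGroup E] [NormedSpace ℝ E]
    {f : ℝ → E} (hf : ContinuousOn f (Ioi 0))
    (h : f =O[𝓝[>] 0] fun x : ℝ => x ^ s) (X : ℝ) :
    ∃ M, 0 ≤ M ∧ ∀ x ∈ Ioc 0 X, ‖f x‖ ≤ M * x ^ s := by
  obtain ⟨M, hM, hbound⟩ := h.exists_nonneg
  obtain ⟨d, hd, hd'⟩ := mem_nhdsGT_iff_exists_Ioo_subset.1 hbound.bound
  have hIcc : Icc d X ⊆ Ioi 0 := fun x hx => lt_of_lt_of_le hd hx.1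
  obtain ⟨N, hN⟩ := isCompact_Icc.exists_bound_of_continuousOn
    (((continuousOn_rpow_Ioi (-s)).smul hf).mono hIcc)
  refine ⟨max M N, hM.trans (le_max_left _ _), fun x hx => ?_⟩
  have hxs : 0 < x ^ s := Real.rpow_pos_of_pos hx.1 s
  rcases lt_or_ge x d with hxd | hxd
  · have := hd' ⟨hx.1, hxd⟩
    rw [mem_ofPred_eq, Real.norm_of_nonneg hxs.le] at this
    exact this.trans (by gcongr; exact le_max_left _ _)
  · have := hN x ⟨hxd, hx.2⟩
    rw [Pi.smul_apply', norm_smul, Real.rpow_neg hx.1.le, norm_inv, Real.norm_of_nonneg hxs.le,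
      inv_mul_le_iff₀ hxs, mul_comm] at this
    exact this.trans (by gcongr; exact le_max_right _ _)

theorem mem_potentialClass_iff :
    p ∈ PotentialClass ε ↔ ∀ X : ℝ, IntegrableOn (fun y : ℝ => y ^ (1 - ε) • p y) (Ioc 0 X) := by
  have hnorm : EqOn (fun y : ℝ => ‖y ^ (1 - ε) • p y‖) (fun y => y ^ (1 - ε) * ‖p y‖)
      (Ioo 0 1) := fun y hy => by
    simp only [norm_smul, Real.norm_of_nonneg (Real.rpow_nonneg hy.1.le _)]
  constructor
  · rintro ⟨hp, hp'⟩ X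
    have hloc : LocallyIntegrableOn (fun y : ℝ => y ^ (1 - ε) • p y) (Ioi 0) :=
      hp.continuousOn_smul isOpen_Ioi.isLocallyClosed (continuousOn_rpow_Ioi _)
    have hzero : IntegrableOn (fun y : ℝ => y ^ (1 - ε) • p y) (Ioo 0 1) :=
      (integrable_norm_iff (hloc.aestronglyMeasurable.mono_measure
        (Measure.restrict_mono Ioo_subset_Ioi_self le_rfl))).1
        (hp'.congr_fun hnorm.symm measurableSet_Ioo)
    have hone : IntegrableOn (fun y : ℝ => y ^ (1 - ε) • p y) (Icc 1 X) :=
      hloc.integrableOn_compact_subset (fun y hy => lt_of_lt_of_le one_pos hy.1) isCompact_Icc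
    refine (hzero.union hone).mono_set fun y hy => ?_
    exact (lt_or_ge y 1).imp (fun h => ⟨hy.1, h⟩) fun h => ⟨h, hy.2⟩
  · intro h
    refine ⟨?_, (IntegrableOn.congr_fun ((h 1).mono_set Ioo_subset_Ioc_self).norm hnorm
      measurableSet_Ioo)⟩
    refine ((locallyIntegrableOn_of_integrableOn_Ioc h).continuousOn_smul
      isOpen_Ioi.isLocallyClosed (continuousOn_rpow_Ioi (ε - 1))).congr ?_
    refine ae_restrict_of_forall_mem measurableSet_Ioi fun y hy => ?_
    beta_reduce
    rw [smul_smul, ← Real.rpow_add hy, sub_add_sub_cancel, sub_self, Real.rpow_zero, one_smul]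

theorem mul_mem_potentialClass (hp : p ∈ PotentialClass ε)
    (hf : AEStronglyMeasurable f (volume.restrict (Ioi 0)))
    (hfs : ∀ X : ℝ, ∃ M : ℝ, ∀ᵐ y ∂volume.restrict (Ioc 0 X), ‖f y‖ ≤ M * y ^ s)
    (hδ : δ ≤ ε + s) : (fun x => p x * f x) ∈ PotentialClass δ := by
  refine mem_potentialClass_iff.2 fun X => ?_
  obtain ⟨M, hM⟩ := hfs X
  have hmeas : AEStronglyMeasurable (fun y : ℝ => y ^ (1 - δ) • (p y * f y))
      (volume.restrict (Ioi 0)) :=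
    ((continuousOn_rpow_Ioi _).aestronglyMeasurable measurableSet_Ioi).smul
      (hp.1.aestronglyMeasurable.mul hf)
  refine Integrable.mono' ((mem_potentialClass_iff.1 hp X).norm.const_mul (M * X ^ (ε + s - δ)))
    (hmeas.mono_measure (Measure.restrict_mono Ioc_subset_Ioi_self le_rfl)) ?_
  filter_upwards [hM, ae_restrict_mem measurableSet_Ioc] with y hMy hy
  have hM0 : 0 ≤ M := nonneg_of_mul_nonneg_left ((norm_nonneg _).trans hMy)
    (Real.rpow_pos_of_pos hy.1 s)
  have hy0 : ∀ t : ℝ, ‖y ^ t‖ = y ^ t := fun t => Real.norm_of_nonneg (Real.rpow_nonneg hy.1.le t)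
  have hsplit : y ^ (1 - δ) = y ^ (ε + s - δ) * y ^ (1 - ε) * y ^ (-s) := by
    rw [← Real.rpow_add hy.1, ← Real.rpow_add hy.1]
    ring_nf
  have hle : y ^ (-s) * ‖f y‖ ≤ M := by
    rw [Real.rpow_neg hy.1.le, inv_mul_le_iff₀ (Real.rpow_pos_of_pos hy.1 s), mul_comm]
    exact hMy
  have hX : y ^ (ε + s - δ) ≤ X ^ (ε + s - δ) :=
    Real.rpow_le_rpow hy.1.le hy.2 (by linarith)
  calc ‖y ^ (1 - δ) • (p y * f y)‖
      = (y ^ (-s) * ‖f y‖) * y ^ (ε + s - δ) * (y ^ (1 - ε) * ‖p y‖) := by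
        rw [norm_smul, norm_mul, hy0, hsplit]
        ring
    _ ≤ M * X ^ (ε + s - δ) * (y ^ (1 - ε) * ‖p y‖) := by
        have := hy.1.le
        gcongr
    _ = M * X ^ (ε + s - δ) * ‖y ^ (1 - ε) • p y‖ := by rw [norm_smul, hy0]

theorem mul_mem_potentialClass_of_isBigO_right (hp : p ∈ PotentialClass ε)
    (hf : ContinuousOn f (Ioi 0)) (hfs : f =O[𝓝[>] 0] fun x : ℝ => x ^ s) (hδ : δ ≤ ε + s) :
    (fun x => p x * f x) ∈ PotentialClass δ := by
  refine mul_mem_potentialClass hp (hf.aestronglyMeasurable measurableSet_Ioi) (fun X => ?_) hδ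
  obtain ⟨M, -, hM⟩ := exists_norm_le_rpow_of_isBigO hf hfs X
  exact ⟨M, ae_restrict_of_forall_mem measurableSet_Ioc hM⟩

theorem mul_mem_potentialClass_of_isBigO_left (hf : ContinuousOn f (Ioi 0))
    (hfs : f =O[𝓝[>] 0] fun x : ℝ => x ^ s) (hp : p ∈ PotentialClass ε) (hδ : δ ≤ ε + s) :
    (fun x => f x * p x) ∈ PotentialClass δ := by
  simpa only [mul_comm] using mul_mem_potentialClass_of_isBigO_right hp hf hfs hδ

theorem antitone_potentialClass : Antitone PotentialClass := by
  intro δ ε h p hp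
  simpa using mul_mem_potentialClass_of_isBigO_right (f := fun _ => 1) (s := 0) (δ := δ) hp
    continuousOn_const (by simpa using isBigO_refl (fun _ : ℝ => (1 : ℂ)) _) (by simpa)

theorem add_mem_potentialClass (hp : p ∈ PotentialClass ε) (hq : q ∈ PotentialClass ε) :
    (fun x => p x + q x) ∈ PotentialClass ε := by
  rw [mem_potentialClass_iff] at *
  exact fun X => ((hp X).add (hq X)).congr (.of_forall fun y => (smul_add _ _ _).symm)

theorem const_mul_mem_potentialClass (c : ℂ) (hp : p ∈ PotentialClass ε) :
    (fun x => c * p x) ∈ PotentialClass ε := by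
  rw [mem_potentialClass_iff] at *
  exact fun X => ((hp X).const_mul c).congr
    (.of_forall fun y => mul_smul_comm _ _ _)

theorem one_mem_potentialClass (hε : ε < 2) : (fun _ => 1 : ℝ → ℂ) ∈ PotentialClass ε := by
  refine mem_potentialClass_iff.2 fun X => ?_
  have h := intervalIntegral.intervalIntegrable_rpow' (a := 0) (b := max X 0)
    (r := 1 - ε) (by linarith)
  rw [intervalIntegrable_iff_integrableOn_Ioc_of_le (le_max_right _ _)] at h
  exact (h.mono_set (Ioc_subset_Ioc_right (le_max_left _ _))).smul_const 1

theorem integrableOn_of_mem_potentialClass_one (hp : p ∈ PotentialClass 1) (X : ℝ) :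
    IntegrableOn p (Ioc 0 X) := by
  simpa using mem_potentialClass_iff.1 hp X

theorem isLittleO_integral_of_mem_potentialClass (hp : p ∈ PotentialClass (1 + b)) (hb : 0 ≤ b) :
    (fun x : ℝ => ∫ y in (0 : ℝ)..x, p y) =o[𝓝[>] 0] fun x : ℝ => x ^ b := by
  have hint := fun X => (mem_potentialClass_iff.1 hp X).norm
  have hlittle : (fun x : ℝ => x ^ b * ∫ y in (0 : ℝ)..x, ‖y ^ (1 - (1 + b)) • p y‖)
      =o[𝓝[>] 0] fun x : ℝ => x ^ b * 1 :=
    (isBigO_refl _ _).mul_isLittleO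
      ((isLittleO_one_iff ℝ).2 (tendsto_integral_zero one_pos (hint 1)))
  simp only [mul_one] at hlittle
  refine (IsBigO.of_bound' ?_).trans_isLittleO hlittle
  filter_upwards [self_mem_nhdsWithin] with x (hx : 0 < x)
  rw [← intervalIntegral.integral_const_mul]
  refine (intervalIntegral.norm_integral_le_of_norm_le hx.le (.of_forall fun y hy => ?_)
    (((intervalIntegrable_iff_integrableOn_Ioc_of_le hx.le).2 (hint x)).const_mul _)).trans
    (le_abs_self _)
  have hy0 : 0 < y ^ b := Real.rpow_pos_of_pos hy.1 b
  rw [norm_smul, sub_add_cancel_left, Real.rpow_neg hy.1.le, norm_inv,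
    Real.norm_of_nonneg hy0.le, ← mul_assoc, ← div_eq_mul_inv]
  exact le_mul_of_one_le_left (norm_nonneg _)
    ((one_le_div₀ hy0).2 (Real.rpow_le_rpow hy.1.le hy.2 hb))

theorem isBigO_integral_one_of_mem_potentialClass (hp : p ∈ PotentialClass (1 + b)) (hb : b ≤ 0) :
    (fun x : ℝ => ∫ y in x..1, p y) =O[𝓝[>] 0] fun x : ℝ => x ^ b := by
  have hint := (intervalIntegrable_iff_integrableOn_Ioc_of_le zero_le_one).2
    (mem_potentialClass_iff.1 hp 1).norm
  refine IsBigO.of_bound (∫ y in (0 : ℝ)..1, ‖y ^ (1 - (1 + b)) • p y‖) ?_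
  filter_upwards [Ioo_mem_nhdsGT one_pos] with x hx
  rw [Real.norm_of_nonneg (Real.rpow_nonneg hx.1.le b), mul_comm,
    ← intervalIntegral.integral_const_mul]
  have hsub : IntervalIntegrable (fun y => x ^ b * ‖y ^ (1 - (1 + b)) • p y‖) volume x 1 :=
    (hint.const_mul _).mono_set (uIcc_subset_uIcc_right
      (by rw [uIcc_of_le zero_le_one]; exact Ioo_subset_Icc_self hx))
  refine (intervalIntegral.norm_integral_le_of_norm_le hx.2.le (.of_forall fun y hy => ?_)
    hsub).trans (intervalIntegral.integral_mono_interval hx.1.le hx.2.le le_rfl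
      (.of_forall fun y => mul_nonneg (Real.rpow_nonneg hx.1.le b) (norm_nonneg _))
      (hint.const_mul _))
  have hy : x < y := hy.1
  have hy0 : 0 < y := hx.1.trans hy
  have hyb : 0 < y ^ b := Real.rpow_pos_of_pos hy0 b
  rw [norm_smul, sub_add_cancel_left, Real.rpow_neg hy0.le, norm_inv,
    Real.norm_of_nonneg hyb.le, ← mul_assoc, ← div_eq_mul_inv]
  exact le_mul_of_one_le_left (norm_nonneg _)
    ((one_le_div₀ hyb).2 (Real.rpow_le_rpow_of_nonpos hx.1 hy.le hb))

end PotentialClass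

/-- `f`, with derivative `D`, solves the inhomogeneous equation `-f'' + V f = p` on `]0,∞[`. -/
structure SolvesWith (V p f D : ℝ → ℂ) : Prop where
  isLocalPrimitive : IsLocalPrimitive D f
  isLocalPrimitive_deriv : IsLocalPrimitive (fun x => V x * f x - p x) D

namespace SolvesWith

variable {V p q f g D E : ℝ → ℂ}

theorem hasDerivAt (h : SolvesWith V p f D) {x : ℝ} (hx : 0 < x) : HasDerivAt f (D x) x :=
  h.isLocalPrimitive.hasDerivAt h.isLocalPrimitive_deriv.continuousOn hx

theorem continuousOn (h : SolvesWith V p f D) : ContinuousOn f (Ioi 0) :=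
  h.isLocalPrimitive.continuousOn

theorem of_hasDerivAt (hV : ContinuousOn V (Ioi 0)) (hf : ∀ x : ℝ, 0 < x → HasDerivAt f (D x) x)
    (hD : ∀ x : ℝ, 0 < x → HasDerivAt D (V x * f x) x) : SolvesWith V 0 f D where
  isLocalPrimitive := .of_hasDerivAt hf fun x hx => (hD x hx).continuousAt.continuousWithinAt
  isLocalPrimitive_deriv := by
    simpa only [Pi.zero_apply, sub_zero] using IsLocalPrimitive.of_hasDerivAt hD
      (hV.mul fun x hx => (hf x hx).continuousAt.continuousWithinAt)

theorem congr (h : SolvesWith V p f D) (hp : EqOn p q (Ioi 0)) (hf : EqOn f g (Ioi 0)) :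
    SolvesWith V q g D where
  isLocalPrimitive := h.isLocalPrimitive.congr (eqOn_refl _ _) hf
  isLocalPrimitive_deriv := h.isLocalPrimitive_deriv.congr
    (fun x hx => by simp only [hp hx, hf hx]) (eqOn_refl _ _)

theorem add (h : SolvesWith V p f D) (h' : SolvesWith V q g E) :
    SolvesWith V (fun x => p x + q x) (fun x => f x + g x) (fun x => D x + E x) where
  isLocalPrimitive := h.isLocalPrimitive.add h'.isLocalPrimitive
  isLocalPrimitive_deriv := (h.isLocalPrimitive_deriv.add h'.isLocalPrimitive_deriv).congr
    (fun x _ => by ring) (eqOn_refl _ _)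

theorem const_mul (c : ℂ) (h : SolvesWith V p f D) :
    SolvesWith V (fun x => c * p x) (fun x => c * f x) (fun x => c * D x) where
  isLocalPrimitive := h.isLocalPrimitive.const_mul c
  isLocalPrimitive_deriv := (h.isLocalPrimitive_deriv.const_mul c).congr
    (fun x _ => by ring) (eqOn_refl _ _)

theorem isLocalPrimitive_wronskian (h : SolvesWith V p f D) (h' : SolvesWith V q g E) :
    IsLocalPrimitive (fun x => p x * g x - f x * q x) (fun x => f x * E x - D x * g x) :=
  ((h.isLocalPrimitive.mul h'.isLocalPrimitive_deriv).add
    ((h.isLocalPrimitive_deriv.mul h'.isLocalPrimitive).const_mul (-1))).congr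
    (fun x _ => by ring) (fun x _ => by ring)

end SolvesWith

/-- A fundamental system `u, v` of `-f'' + V f = 0` on `]0,∞[`, with derivatives `u', v'` and
Wronskian `1`, where near `0` the function `u` is of order `x^{1/2+ρ}` and `v` of order
`x^{1/2-ρ}`. -/
structure FundamentalSystem (ρ : ℝ) (V u v u' v' : ℝ → ℂ) : Prop where
  nonneg : 0 ≤ ρ
  solvesWith_u : SolvesWith V 0 u u'
  solvesWith_v : SolvesWith V 0 v v'
  wronskian : ∀ x : ℝ, 0 < x → v x * u' x - v' x * u x = 1
  isBigO_u : u =O[𝓝[>] 0] fun x : ℝ => x ^ (1 / 2 + ρ)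
  isBigO_deriv_u : u' =O[𝓝[>] 0] fun x : ℝ => x ^ (-1 / 2 + ρ)
  isBigO_v : v =O[𝓝[>] 0] fun x : ℝ => x ^ (1 / 2 - ρ)
  isBigO_deriv_v : v' =O[𝓝[>] 0] fun x : ℝ => x ^ (-1 / 2 - ρ)

/-- The forward Green operator of a fundamental system `u, v`, which gives the solution of
`-f'' + V f = p` that vanishes fastest at `0`. -/
noncomputable def forwardOp (u v p : ℝ → ℂ) (x : ℝ) : ℂ :=
  v x * (∫ y in (0 : ℝ)..x, u y * p y) - u x * ∫ y in (0 : ℝ)..x, v y * p y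

/-- The two-sided Green operator on `]0,1[` of a fundamental system `u, v`, continued to `]0,∞[`
as a solution of `-f'' + V f = p`. -/
noncomputable def twoSidedOp (u v p : ℝ → ℂ) (x : ℝ) : ℂ :=
  v x * (∫ y in (0 : ℝ)..x, u y * p y) + u x * ∫ y in x..1, v y * p y

theorem isBigO_rpow_rpow {s t : ℝ} (h : t ≤ s) :
    (fun x : ℝ => x ^ s) =O[𝓝[>] 0] fun x : ℝ => x ^ t := by
  refine IsBigO.of_bound' ?_
  filter_upwards [Ioc_mem_nhdsGT one_pos] with x hx
  rw [Real.norm_of_nonneg (Real.rpow_nonneg hx.1.le _),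
    Real.norm_of_nonneg (Real.rpow_nonneg hx.1.le _)]
  exact Real.rpow_le_rpow_of_exponent_ge hx.1 hx.2 h

theorem isBigO_mul_rpow {f g : ℝ → ℂ} {s t r : ℝ}
    (hf : f =O[𝓝[>] 0] fun x : ℝ => x ^ s) (hg : g =O[𝓝[>] 0] fun x : ℝ => x ^ t) (h : r ≤ s + t) :
    (fun x => f x * g x) =O[𝓝[>] 0] fun x : ℝ => x ^ r := by
  refine ((hf.mul hg).congr' .rfl ?_).trans (isBigO_rpow_rpow h)
  filter_upwards [self_mem_nhdsWithin] with x hx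
  rw [Real.rpow_add hx]

theorem isLittleO_mul_rpow {f g : ℝ → ℂ} {s t r : ℝ}
    (hf : f =O[𝓝[>] 0] fun x : ℝ => x ^ s) (hg : g =o[𝓝[>] 0] fun x : ℝ => x ^ t) (h : r = s + t) :
    (fun x => f x * g x) =o[𝓝[>] 0] fun x : ℝ => x ^ r :=
  (hf.mul_isLittleO hg).congr' .rfl <| by
    filter_upwards [self_mem_nhdsWithin] with x hx
    rw [h, Real.rpow_add hx]

namespace FundamentalSystem

variable {ρ b : ℝ} {V u v u' v' p q A B : ℝ → ℂ}

theorem continuousOn_u (S : FundamentalSystem ρ V u v u' v') : ContinuousOn u (Ioi 0) :=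
  S.solvesWith_u.continuousOn

theorem continuousOn_v (S : FundamentalSystem ρ V u v u' v') : ContinuousOn v (Ioi 0) :=
  S.solvesWith_v.continuousOn

theorem solvesWith_variation_of_parameters (S : FundamentalSystem ρ V u v u' v')
    (hA : IsLocalPrimitive (fun x => u x * p x) A)
    (hB : IsLocalPrimitive (fun x => -(v x * p x)) B) :
    SolvesWith V p (fun x => v x * A x + u x * B x) (fun x => v' x * A x + u' x * B x) where
  isLocalPrimitive := ((S.solvesWith_v.isLocalPrimitive.mul hA).add
    (S.solvesWith_u.isLocalPrimitive.mul hB)).congr (fun x _ => by ring) (eqOn_refl _ _)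
  isLocalPrimitive_deriv := by
    refine ((S.solvesWith_v.isLocalPrimitive_deriv.mul hA).add
      (S.solvesWith_u.isLocalPrimitive_deriv.mul hB)).congr (fun x hx => ?_) (eqOn_refl _ _)
    simp only [Pi.zero_apply]
    linear_combination (-p x) * S.wronskian x hx

theorem u_mul_mem_potentialClass (S : FundamentalSystem ρ V u v u' v')
    (hp : p ∈ PotentialClass (1 / 2 - ρ + b)) :
    (fun x => u x * p x) ∈ PotentialClass (1 + b) :=
  mul_mem_potentialClass_of_isBigO_left S.continuousOn_u S.isBigO_u hp (by linarith)

theorem v_mul_mem_potentialClass (S : FundamentalSystem ρ V u v u' v')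
    (hp : p ∈ PotentialClass (1 / 2 + ρ + b)) :
    (fun x => v x * p x) ∈ PotentialClass (1 + b) :=
  mul_mem_potentialClass_of_isBigO_left S.continuousOn_v S.isBigO_v hp (by linarith)

theorem integrableOn_u_mul (S : FundamentalSystem ρ V u v u' v')
    (hp : p ∈ PotentialClass (1 / 2 - ρ)) (X : ℝ) :
    IntegrableOn (fun y => u y * p y) (Ioc 0 X) :=
  integrableOn_of_mem_potentialClass_one
    (by simpa using S.u_mul_mem_potentialClass (b := 0) (by simpa using hp)) X

theorem integrableOn_v_mul (S : FundamentalSystem ρ V u v u' v')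
    (hp : p ∈ PotentialClass (1 / 2 + ρ)) (X : ℝ) :
    IntegrableOn (fun y => v y * p y) (Ioc 0 X) :=
  integrableOn_of_mem_potentialClass_one
    (by simpa using S.v_mul_mem_potentialClass (b := 0) (by simpa using hp)) X

theorem mem_potentialClass_sub (S : FundamentalSystem ρ V u v u' v')
    (hp : p ∈ PotentialClass (1 / 2 + ρ)) : p ∈ PotentialClass (1 / 2 - ρ) :=
  antitone_potentialClass (by linarith [S.nonneg]) hp

theorem exists_solvesWith_forwardOp (S : FundamentalSystem ρ V u v u' v')
    (hp : p ∈ PotentialClass (1 / 2 + ρ)) :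
    ∃ D : ℝ → ℂ, SolvesWith V p (forwardOp u v p) D ∧
      (forwardOp u v p =o[𝓝[>] 0] fun x : ℝ => x ^ (1 / 2 + ρ)) ∧
      D =o[𝓝[>] 0] fun x : ℝ => x ^ (-1 / 2 + ρ) := by
  have hA : (fun x : ℝ => ∫ y in (0 : ℝ)..x, u y * p y) =o[𝓝[>] 0] fun x : ℝ => x ^ (2 * ρ) :=
    isLittleO_integral_of_mem_potentialClass
      (S.u_mul_mem_potentialClass (by convert hp using 2; ring)) (by linarith [S.nonneg])
  have hB : (fun x : ℝ => -∫ y in (0 : ℝ)..x, v y * p y) =o[𝓝[>] 0] fun x : ℝ => x ^ (0 : ℝ) :=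
    (isLittleO_integral_of_mem_potentialClass
      (S.v_mul_mem_potentialClass (by simpa using hp)) le_rfl).neg_left
  have hsolves := S.solvesWith_variation_of_parameters
    (.of_integrableOn_Ioc (S.integrableOn_u_mul (S.mem_potentialClass_sub hp)))
    (((IsLocalPrimitive.of_integrableOn_Ioc (S.integrableOn_v_mul hp)).const_mul (-1)).congr
      (g := fun x => -(v x * p x)) (G := fun x => -∫ y in (0 : ℝ)..x, v y * p y)
      (fun x _ => neg_one_mul _) (fun x _ => neg_one_mul _))
  have hforward : forwardOp u v p = fun x =>
      v x * (∫ y in (0 : ℝ)..x, u y * p y) + u x * -∫ y in (0 : ℝ)..x, v y * p y := by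
    ext x
    rw [forwardOp, mul_neg, sub_eq_add_neg]
  refine ⟨_, hforward ▸ hsolves, hforward ▸ ?_, ?_⟩
  · exact (isLittleO_mul_rpow S.isBigO_v hA (by ring)).add
      (isLittleO_mul_rpow S.isBigO_u hB (by ring))
  · exact (isLittleO_mul_rpow S.isBigO_deriv_v hA (by ring)).add
      (isLittleO_mul_rpow S.isBigO_deriv_u hB (by ring))

theorem exists_solvesWith_twoSidedOp (S : FundamentalSystem ρ V u v u' v')
    (hp : p ∈ PotentialClass (1 / 2 - ρ)) :
    ∃ D : ℝ → ℂ, SolvesWith V p (twoSidedOp u v p) D := by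
  have hloc : LocallyIntegrableOn (fun y => v y * p y) (Ioi 0) :=
    hp.1.continuousOn_mul S.continuousOn_v isOpen_Ioi.isLocallyClosed
  refine ⟨_, S.solvesWith_variation_of_parameters (.of_integrableOn_Ioc (S.integrableOn_u_mul hp))
    (B := fun x => ∫ y in x..1, v y * p y) ⟨hloc.neg, fun a b ha hb => ?_⟩⟩
  rw [intervalIntegral.integral_neg, ← intervalIntegral.integral_add_adjacent_intervals
    (intervalIntegrable_of_locallyIntegrableOn hloc ha hb)
    (intervalIntegrable_of_locallyIntegrableOn hloc hb one_pos), sub_add_cancel_right]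

theorem isBigO_twoSidedOp (S : FundamentalSystem ρ V u v u' v')
    (hp : p ∈ PotentialClass (1 / 2 - ρ + b)) (hb : 0 ≤ b) (hbρ : b ≤ 2 * ρ) :
    twoSidedOp u v p =O[𝓝[>] 0] fun x : ℝ => x ^ (1 / 2 - ρ + b) := by
  have hA : (fun x : ℝ => ∫ y in (0 : ℝ)..x, u y * p y) =O[𝓝[>] 0] fun x : ℝ => x ^ b :=
    (isLittleO_integral_of_mem_potentialClass (S.u_mul_mem_potentialClass hp) hb).isBigO
  have hB : (fun x : ℝ => ∫ y in x..1, v y * p y) =O[𝓝[>] 0] fun x : ℝ => x ^ (b - 2 * ρ) :=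
    isBigO_integral_one_of_mem_potentialClass
      (S.v_mul_mem_potentialClass (by convert hp using 2; ring)) (by linarith)
  exact (isBigO_mul_rpow S.isBigO_v hA le_rfl).add
    (isBigO_mul_rpow S.isBigO_u hB (by linarith))

theorem forwardOp_sub (S : FundamentalSystem ρ V u v u' v')
    (hp : p ∈ PotentialClass (1 / 2 + ρ)) (hq : q ∈ PotentialClass (1 / 2 + ρ)) {x : ℝ}
    (hx : 0 < x) :
    forwardOp u v (fun y => p y - q y) x = forwardOp u v p x - forwardOp u v q x := by
  have hu : ∀ g ∈ PotentialClass (1 / 2 + ρ),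
      IntervalIntegrable (fun y => u y * g y) volume 0 x := fun g hg =>
    (intervalIntegrable_iff_integrableOn_Ioc_of_le hx.le).2
      (S.integrableOn_u_mul (S.mem_potentialClass_sub hg) x)
  have hv : ∀ g ∈ PotentialClass (1 / 2 + ρ),
      IntervalIntegrable (fun y => v y * g y) volume 0 x := fun g hg =>
    (intervalIntegrable_iff_integrableOn_Ioc_of_le hx.le).2 (S.integrableOn_v_mul hg x)
  simp only [forwardOp, mul_sub, intervalIntegral.integral_sub (hu p hp) (hu q hq),
    intervalIntegral.integral_sub (hv p hp) (hv q hq)]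
  ring

end FundamentalSystem

section PotentialMass

variable {Q : ℝ → ℂ} {x y : ℝ}

/-- The weighted mass `∫₀ˣ y |Q(y)| dy` of a potential, which controls the Volterra iteration. -/
noncomputable def potentialMass (Q : ℝ → ℂ) (x : ℝ) : ℝ := ∫ y in (0 : ℝ)..x, y * ‖Q y‖

theorem integral_mul_primitive_pow {q : ℝ → ℝ} (hq : IntervalIntegrable q volume 0 x) (j : ℕ) :
    ∫ y in (0 : ℝ)..x, q y * (∫ t in (0 : ℝ)..y, q t) ^ j =
      (∫ t in (0 : ℝ)..x, q t) ^ (j + 1) / (j + 1) := by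
  have hderiv : ∀ᵐ y, y ∈ uIoc 0 x → deriv (fun y => (∫ t in (0 : ℝ)..y, q t) ^ (j + 1)) y =
      (j + 1) * (q y * (∫ t in (0 : ℝ)..y, q t) ^ j) := by
    filter_upwards [hq.ae_hasDerivAt_integral] with y hy hyx
    have hpow := (hy (uIoc_subset_uIcc hyx) 0 left_mem_uIcc).fun_pow (j + 1)
    rw [hpow.deriv, Nat.add_sub_cancel]
    push_cast
    ring
  have hac : AbsolutelyContinuousOnInterval (fun y => (∫ t in (0 : ℝ)..y, q t) ^ (j + 1)) 0 x := by
    induction j + 1 with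
    | zero =>
      simpa using (LipschitzWith.const (1 : ℝ)).lipschitzOnWith.absolutelyContinuousOnInterval
    | succ i ih =>
      simpa only [pow_succ] using ih.fun_mul (absolutelyContinuousOnInterval_integral hq)
  have hint := hac.integral_deriv_eq_sub
  rw [intervalIntegral.integral_congr_ae hderiv, intervalIntegral.integral_const_mul,
    intervalIntegral.integral_same, zero_pow j.succ_ne_zero, sub_zero] at hint
  rw [eq_div_iff (by positivity), ← hint, mul_comm]

theorem intervalIntegrable_mul_norm (hQ : Q ∈ PotentialClass 0) (hx : 0 < x) :
    IntervalIntegrable (fun y => y * ‖Q y‖) volume 0 x := by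
  refine (intervalIntegrable_iff_integrableOn_Ioc_of_le hx.le).2
    ((mem_potentialClass_iff.1 hQ x).norm.congr ?_)
  filter_upwards [ae_restrict_mem measurableSet_Ioc] with y hy
  rw [sub_zero, Real.rpow_one, norm_smul, Real.norm_of_nonneg hy.1.le]

theorem potentialMass_nonneg (hx : 0 ≤ x) : 0 ≤ potentialMass Q x :=
  intervalIntegral.integral_nonneg hx fun _ hy => mul_nonneg hy.1 (norm_nonneg _)

theorem potentialMass_le_potentialMass (hQ : Q ∈ PotentialClass 0) (hx : 0 < x) (hxy : x ≤ y) :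
    potentialMass Q x ≤ potentialMass Q y :=
  intervalIntegral.integral_mono_interval le_rfl hx.le hxy
    (ae_restrict_of_forall_mem measurableSet_Ioc fun _ ht => mul_nonneg ht.1.le (norm_nonneg _))
    (intervalIntegrable_mul_norm hQ (hx.trans_le hxy))

theorem intervalIntegrable_mul_potentialMass_pow (hQ : Q ∈ PotentialClass 0) (hx : 0 < x) (j : ℕ) :
    IntervalIntegrable (fun y => y * ‖Q y‖ * potentialMass Q y ^ j) volume 0 x :=
  (intervalIntegrable_mul_norm hQ hx).mul_continuousOn
    ((intervalIntegral.continuousOn_primitive_interval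
      ((intervalIntegrable_iff').1 (intervalIntegrable_mul_norm hQ hx))).pow j)

end PotentialMass

theorem isBigO_rpow_of_forall_norm_le {E : Type*} [NormedAddCommGroup E] {f : ℝ → E} {s M X : ℝ}
    (hX : 0 < X) (h : ∀ x ∈ Ioc 0 X, ‖f x‖ ≤ M * x ^ s) : f =O[𝓝[>] 0] fun x : ℝ => x ^ s := by
  refine IsBigO.of_bound M ?_
  filter_upwards [Ioc_mem_nhdsGT hX] with x hx
  rw [Real.norm_of_nonneg (Real.rpow_nonneg hx.1.le s)]
  exact h x hx

theorem norm_integral_mul_le {w p : ℝ → ℂ} {q : ℝ → ℝ} {s x K : ℝ} (hx : 0 ≤ x) (hK : 0 ≤ K)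
    (hw : ∀ y ∈ Ioc 0 x, ‖w y‖ ≤ K * y ^ s) (hq : IntervalIntegrable q volume 0 x)
    (hp : ∀ᵐ y ∂volume.restrict (Ioc 0 x), y ^ s * ‖p y‖ ≤ q y) :
    ‖∫ y in (0 : ℝ)..x, w y * p y‖ ≤ K * ∫ y in (0 : ℝ)..x, q y := by
  rw [← intervalIntegral.integral_const_mul]
  refine intervalIntegral.norm_integral_le_of_norm_le hx ?_ (hq.const_mul K)
  filter_upwards [(ae_restrict_iff' measurableSet_Ioc).1 hp] with y hpy hy
  calc ‖w y * p y‖ = ‖w y‖ * ‖p y‖ := norm_mul _ _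
    _ ≤ K * y ^ s * ‖p y‖ := mul_le_mul_of_nonneg_right (hw y hy) (norm_nonneg _)
    _ = K * (y ^ s * ‖p y‖) := mul_assoc _ _ _
    _ ≤ K * q y := mul_le_mul_of_nonneg_left (hpy hy) hK

theorem rpow_mul_norm_mul_le {ρ y b : ℝ} {q z : ℂ} (hy : 0 < y)
    (h : ‖z‖ ≤ b * y ^ (1 / 2 + ρ)) : y ^ (1 / 2 - ρ) * ‖q * z‖ ≤ b * (y * ‖q‖) := by
  have hsplit : y = y ^ (1 / 2 - ρ) * y ^ (1 / 2 + ρ) := by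
    rw [← Real.rpow_add hy, sub_add_add_cancel, add_halves, Real.rpow_one]
  calc y ^ (1 / 2 - ρ) * ‖q * z‖ = y ^ (1 / 2 - ρ) * ‖q‖ * ‖z‖ := by rw [norm_mul, mul_assoc]
    _ ≤ y ^ (1 / 2 - ρ) * ‖q‖ * (b * y ^ (1 / 2 + ρ)) := by gcongr
    _ = b * (y ^ (1 / 2 - ρ) * y ^ (1 / 2 + ρ) * ‖q‖) := by ring
    _ = b * (y * ‖q‖) := by rw [← hsplit]

theorem hasSum_integral_mul_of_norm_le {ρ x : ℝ} {w Q : ℝ → ℂ} {R : ℕ → ℝ → ℂ} {a : ℕ → ℝ}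
    (hQ : Q ∈ PotentialClass 0) (hw : ContinuousOn w (Ioi 0))
    (hwO : w =O[𝓝[>] 0] fun y : ℝ => y ^ (1 / 2 - ρ)) (hR : ∀ j, ContinuousOn (R j) (Ioi 0))
    (ha : Summable a) (hRa : ∀ j, ∀ y ∈ Ioc 0 x, ‖R j y‖ ≤ a j * y ^ (1 / 2 + ρ)) (hx : 0 < x) :
    HasSum (fun j => ∫ y in (0 : ℝ)..x, w y * (Q y * R j y))
      (∫ y in (0 : ℝ)..x, w y * (Q y * ∑' j, R j y)) := by
  obtain ⟨K, hK, hwK⟩ := exists_norm_le_rpow_of_isBigO hw hwO x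
  have hIoc : uIoc 0 x = Ioc 0 x := uIoc_of_le hx.le
  refine intervalIntegral.hasSum_integral_of_dominated_convergence
    (fun j y => K * a j * (y * ‖Q y‖)) (fun j => ?_) (fun j => .of_forall fun y hy => ?_)
    (.of_forall fun y _ => (ha.mul_left K).mul_right _) ?_ (.of_forall fun y hy => ?_)
  · have hloc : LocallyIntegrableOn (fun y => w y * (Q y * R j y)) (Ioi 0) :=
      (hQ.1.mul_continuousOn (hR j) isOpen_Ioi.isLocallyClosed).continuousOn_mul hw
        isOpen_Ioi.isLocallyClosed
    exact hloc.aestronglyMeasurable.mono_set (hIoc ▸ Ioc_subset_Ioi_self)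
  · rw [hIoc] at hy
    calc ‖w y * (Q y * R j y)‖ = ‖w y‖ * ‖Q y * R j y‖ := norm_mul _ _
      _ ≤ K * y ^ (1 / 2 - ρ) * ‖Q y * R j y‖ := by gcongr; exact hwK y hy
      _ = K * (y ^ (1 / 2 - ρ) * ‖Q y * R j y‖) := mul_assoc _ _ _
      _ ≤ K * (a j * (y * ‖Q y‖)) :=
        mul_le_mul_of_nonneg_left (rpow_mul_norm_mul_le hy.1 (hRa j y hy)) hK
      _ = K * a j * (y * ‖Q y‖) := (mul_assoc _ _ _).symm
  · simp_rw [tsum_mul_right]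
    exact (intervalIntegrable_mul_norm hQ hx).const_mul _
  · rw [hIoc] at hy
    exact ((Summable.of_norm_bounded (ha.mul_right _) fun j => hRa j y hy).hasSum.mul_left
      _).mul_left _

theorem tendsto_mul_zero_of_isBigO_of_isLittleO {f g : ℝ → ℂ} {s t : ℝ} (hst : 0 ≤ s + t)
    (hf : f =O[𝓝[>] 0] fun x : ℝ => x ^ s) (hg : g =o[𝓝[>] 0] fun x : ℝ => x ^ t) :
    Tendsto (fun x => f x * g x) (𝓝[>] 0) (𝓝 0) := by
  refine (isLittleO_one_iff ℝ).1 ((isLittleO_mul_rpow hf hg rfl).trans_isBigO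
    (IsBigO.of_bound' ?_))
  filter_upwards [Ioc_mem_nhdsGT one_pos] with x hx
  rw [Real.norm_of_nonneg (Real.rpow_nonneg hx.1.le _), norm_one]
  exact Real.rpow_le_one hx.1.le hx.2 hst

theorem SolvesWith.wronskian_eq_neg_integral {V w w' p d D : ℝ → ℂ} {s s' t t' : ℝ}
    (hw : SolvesWith V 0 w w') (hd : SolvesWith V p d D)
    (hwO : w =O[𝓝[>] 0] fun x : ℝ => x ^ s) (hwO' : w' =O[𝓝[>] 0] fun x : ℝ => x ^ s')
    (hdo : d =o[𝓝[>] 0] fun x : ℝ => x ^ t) (hDo : D =o[𝓝[>] 0] fun x : ℝ => x ^ t')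
    (hst : 0 ≤ s + t') (hst' : 0 ≤ s' + t)
    (hint : ∀ X : ℝ, IntegrableOn (fun y => w y * p y) (Ioc 0 X)) {x : ℝ} (hx : 0 < x) :
    w x * D x - w' x * d x = -∫ y in (0 : ℝ)..x, w y * p y := by
  have hprimitive : IsLocalPrimitive (fun y => -(w y * p y)) fun y => w y * D y - w' y * d y :=
    (hw.isLocalPrimitive_wronskian hd).congr (fun y _ => by simp) (eqOn_refl _ _)
  rw [← intervalIntegral.integral_neg]
  refine hprimitive.eq_integral_of_tendsto (fun X => (hint X).neg) ?_ hx
  simpa using (tendsto_mul_zero_of_isBigO_of_isLittleO hst hwO hDo).sub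
    (tendsto_mul_zero_of_isBigO_of_isLittleO hst' hwO' hdo)

/-- The iterates `(-G_→ Q)ʲ F` whose sum is the Neumann series of `(1 + G_→ Q)⁻¹ F`. -/
noncomputable def volterraIterate (u v Q F : ℝ → ℂ) : ℕ → ℝ → ℂ
  | 0 => F
  | j + 1 => fun x => -forwardOp u v (fun y => Q y * volterraIterate u v Q F j y) x

namespace FundamentalSystem

variable {ρ X M : ℝ} {V u v u' v' p q Q F T DT d D : ℝ → ℂ}

theorem isBigO_u_sub (S : FundamentalSystem ρ V u v u' v') :
    u =O[𝓝[>] 0] fun x : ℝ => x ^ (1 / 2 - ρ) :=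
  S.isBigO_u.trans (isBigO_rpow_rpow (by linarith [S.nonneg]))

theorem exists_norm_forwardOp_le (S : FundamentalSystem ρ V u v u' v') (X : ℝ) :
    ∃ C, 0 ≤ C ∧ ∀ x ∈ Ioc 0 X, ∀ (p : ℝ → ℂ) (q : ℝ → ℝ), IntervalIntegrable q volume 0 x →
      (∀ᵐ y ∂volume.restrict (Ioc 0 x), y ^ (1 / 2 - ρ) * ‖p y‖ ≤ q y) →
      ‖forwardOp u v p x‖ ≤ C * x ^ (1 / 2 + ρ) * ∫ y in (0 : ℝ)..x, q y := by
  obtain ⟨A, hA, hu⟩ := exists_norm_le_rpow_of_isBigO S.continuousOn_u S.isBigO_u X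
  obtain ⟨B, hB, hv⟩ := exists_norm_le_rpow_of_isBigO S.continuousOn_v S.isBigO_v X
  refine ⟨2 * (A * B), by positivity, fun x hx p q hq hp => ?_⟩
  have hx0 : ∀ t : ℝ, 0 ≤ x ^ t := Real.rpow_nonneg hx.1.le
  have hux : ∀ y ∈ Ioc 0 x, ‖u y‖ ≤ A * x ^ (2 * ρ) * y ^ (1 / 2 - ρ) := fun y hy =>
    calc ‖u y‖ ≤ A * y ^ (1 / 2 + ρ) := hu y ⟨hy.1, hy.2.trans hx.2⟩
      _ = A * y ^ (2 * ρ) * y ^ (1 / 2 - ρ) := by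
        rw [mul_assoc, ← Real.rpow_add hy.1]; ring_nf
      _ ≤ A * x ^ (2 * ρ) * y ^ (1 / 2 - ρ) := by
        have := S.nonneg
        have := hy.1.le
        have := hy.2
        gcongr
  have hIu := norm_integral_mul_le hx.1.le (mul_nonneg hA (hx0 _)) hux hq hp
  have hIv := norm_integral_mul_le hx.1.le hB (fun y hy => hv y ⟨hy.1, hy.2.trans hx.2⟩) hq hp
  have hsplit : x ^ (1 / 2 + ρ) = x ^ (1 / 2 - ρ) * x ^ (2 * ρ) := by
    rw [← Real.rpow_add hx.1]; ring_nf
  calc ‖forwardOp u v p x‖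
      ≤ ‖v x‖ * ‖∫ y in (0 : ℝ)..x, u y * p y‖ + ‖u x‖ * ‖∫ y in (0 : ℝ)..x, v y * p y‖ := by
        rw [← norm_mul, ← norm_mul]; exact norm_sub_le _ _
    _ ≤ B * x ^ (1 / 2 - ρ) * (A * x ^ (2 * ρ) * ∫ y in (0 : ℝ)..x, q y) +
          A * x ^ (1 / 2 + ρ) * (B * ∫ y in (0 : ℝ)..x, q y) :=
        add_le_add
          (mul_le_mul (hv x hx) hIu (norm_nonneg _) (mul_nonneg hB (hx0 _)))
          (mul_le_mul (hu x hx) hIv (norm_nonneg _) (mul_nonneg hA (hx0 _)))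
    _ = 2 * (A * B) * x ^ (1 / 2 + ρ) * ∫ y in (0 : ℝ)..x, q y := by rw [hsplit]; ring

theorem exists_norm_forwardOp_mul_le (S : FundamentalSystem ρ V u v u' v')
    (hQ : Q ∈ PotentialClass 0) (X : ℝ) :
    ∃ C, 0 ≤ C ∧ ∀ x ∈ Ioc 0 X, ∀ (f : ℝ → ℂ) (M : ℝ) (j : ℕ),
      (∀ᵐ y ∂volume.restrict (Ioc 0 x),
        ‖f y‖ ≤ M * ((C * potentialMass Q y) ^ j / j.factorial) * y ^ (1 / 2 + ρ)) →
      ‖forwardOp u v (fun y => Q y * f y) x‖ ≤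
        M * ((C * potentialMass Q x) ^ (j + 1) / (j + 1).factorial) * x ^ (1 / 2 + ρ) := by
  obtain ⟨C, hC, hbound⟩ := S.exists_norm_forwardOp_le X
  refine ⟨C, hC, fun x hx f M j hf => ?_⟩
  refine (hbound x hx _ _ ((intervalIntegrable_mul_potentialMass_pow hQ hx.1 j).const_mul
    (M * (C ^ j / j.factorial))) ?_).trans_eq ?_
  · filter_upwards [hf, ae_restrict_mem measurableSet_Ioc] with y hfy hy
    refine (rpow_mul_norm_mul_le hy.1 hfy).trans_eq ?_
    rw [mul_pow]
    ring
  · have hpow : ∫ y in (0 : ℝ)..x, y * ‖Q y‖ * potentialMass Q y ^ j =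
        potentialMass Q x ^ (j + 1) / (j + 1) :=
      integral_mul_primitive_pow (intervalIntegrable_mul_norm hQ hx.1) j
    rw [intervalIntegral.integral_const_mul, hpow, Nat.factorial_succ]
    push_cast
    field_simp
    ring

theorem eq_zero_of_eq_neg_forwardOp (S : FundamentalSystem ρ V u v u' v')
    (hQ : Q ∈ PotentialClass 0)
    (hM : ∀ᵐ y ∂volume.restrict (Ioo 0 X), ‖d y‖ ≤ M * y ^ (1 / 2 + ρ))
    (hd : ∀ x ∈ Ioo 0 X, d x = -forwardOp u v (fun y => Q y * d y) x) :
    ∀ x ∈ Ioo 0 X, d x = 0 := by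
  obtain ⟨C, -, hstep⟩ := S.exists_norm_forwardOp_mul_le hQ X
  have hbound_succ : ∀ j : ℕ, (∀ᵐ y ∂volume.restrict (Ioo 0 X),
      ‖d y‖ ≤ M * ((C * potentialMass Q y) ^ j / j.factorial) * y ^ (1 / 2 + ρ)) →
      ∀ x ∈ Ioo 0 X, ‖d x‖ ≤
        M * ((C * potentialMass Q x) ^ (j + 1) / (j + 1).factorial) * x ^ (1 / 2 + ρ) := by
    intro j hj x hx
    rw [hd x hx, norm_neg]
    exact hstep x ⟨hx.1, hx.2.le⟩ d M j
      (ae_restrict_of_ae_restrict_of_subset (Ioc_subset_Ioo_right hx.2) hj)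
  have hbound : ∀ j : ℕ, ∀ᵐ y ∂volume.restrict (Ioo 0 X),
      ‖d y‖ ≤ M * ((C * potentialMass Q y) ^ j / j.factorial) * y ^ (1 / 2 + ρ) := by
    intro j
    induction j with
    | zero => simpa using hM
    | succ j ih => exact ae_restrict_of_forall_mem measurableSet_Ioo (hbound_succ j ih)
  intro x hx
  have hlim := (((FloorSemiring.tendsto_pow_div_factorial_atTop (C * potentialMass Q x)).comp
    (tendsto_add_atTop_nat 1)).const_mul M).mul_const (x ^ (1 / 2 + ρ))
  rw [mul_zero, zero_mul] at hlim
  exact norm_le_zero_iff.1 (ge_of_tendsto' hlim fun j => hbound_succ j (hbound j) x hx)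

theorem exists_summable_norm_volterraIterate_le (S : FundamentalSystem ρ V u v u' v')
    (hQ : Q ∈ PotentialClass 0) (hF : ContinuousOn F (Ioi 0))
    (hFO : F =O[𝓝[>] 0] fun x : ℝ => x ^ (1 / 2 + ρ)) (X : ℝ) :
    ∃ a : ℕ → ℝ, Summable a ∧ ∀ j, 0 ≤ a j ∧ ∀ x ∈ Ioc 0 X,
      ‖volterraIterate u v Q F j x‖ ≤ a j * x ^ (1 / 2 + ρ) := by
  obtain ⟨C, hC, hstep⟩ := S.exists_norm_forwardOp_mul_le hQ X
  obtain ⟨M, hM, hFM⟩ := exists_norm_le_rpow_of_isBigO hF hFO X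
  have hbound : ∀ j, ∀ x ∈ Ioc 0 X, ‖volterraIterate u v Q F j x‖ ≤
      M * ((C * potentialMass Q x) ^ j / j.factorial) * x ^ (1 / 2 + ρ) := by
    intro j
    induction j with
    | zero => simpa [volterraIterate] using hFM
    | succ j ih =>
      intro x hx
      rw [volterraIterate, norm_neg]
      exact hstep x hx _ M j (ae_restrict_of_forall_mem measurableSet_Ioc
        fun y hy => ih y ⟨hy.1, hy.2.trans hx.2⟩)
  refine ⟨fun j => M * ((C * |potentialMass Q X|) ^ j / j.factorial),
    (Real.summable_pow_div_factorial _).mul_left M,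
    fun j => ⟨by positivity, fun x hx => (hbound j x hx).trans ?_⟩⟩
  have hmass : potentialMass Q x ≤ |potentialMass Q X| :=
    (potentialMass_le_potentialMass hQ hx.1 hx.2).trans (le_abs_self _)
  have hx0 := hx.1
  have hmass0 : 0 ≤ potentialMass Q x := potentialMass_nonneg hx0.le
  dsimp only
  gcongr

theorem mul_mem_potentialClass (hQ : Q ∈ PotentialClass 0) (hF : ContinuousOn F (Ioi 0))
    (hFO : F =O[𝓝[>] 0] fun x : ℝ => x ^ (1 / 2 + ρ)) :
    (fun x => Q x * F x) ∈ PotentialClass (1 / 2 + ρ) :=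
  mul_mem_potentialClass_of_isBigO_right hQ hF hFO (by linarith)

theorem continuousOn_volterraIterate (S : FundamentalSystem ρ V u v u' v')
    (hQ : Q ∈ PotentialClass 0) (hF : ContinuousOn F (Ioi 0))
    (hFO : F =O[𝓝[>] 0] fun x : ℝ => x ^ (1 / 2 + ρ)) (j : ℕ) :
    ContinuousOn (volterraIterate u v Q F j) (Ioi 0) := by
  obtain ⟨a, -, ha⟩ := S.exists_summable_norm_volterraIterate_le hQ hF hFO 1
  induction j with
  | zero => exact hF
  | succ j ih =>
    obtain ⟨D, hD, -⟩ := S.exists_solvesWith_forwardOp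
      (mul_mem_potentialClass hQ ih (isBigO_rpow_of_forall_norm_le one_pos (ha j).2))
    exact hD.continuousOn.neg

theorem continuousOn_tsum_volterraIterate (S : FundamentalSystem ρ V u v u' v')
    (hQ : Q ∈ PotentialClass 0) (hF : ContinuousOn F (Ioi 0))
    (hFO : F =O[𝓝[>] 0] fun x : ℝ => x ^ (1 / 2 + ρ)) :
    ContinuousOn (fun x => ∑' j, volterraIterate u v Q F j x) (Ioi 0) := by
  intro x (hx : 0 < x)
  obtain ⟨a, ha, hbound⟩ := S.exists_summable_norm_volterraIterate_le hQ hF hFO (x + 1)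
  have hcont := continuousOn_tsum (s := Ioo 0 (x + 1))
    (fun j => (S.continuousOn_volterraIterate hQ hF hFO j).mono Ioo_subset_Ioi_self)
    (ha.mul_right ((x + 1) ^ (1 / 2 + ρ))) fun j y hy => by
      refine ((hbound j).2 y ⟨hy.1, hy.2.le⟩).trans (mul_le_mul_of_nonneg_left ?_ (hbound j).1)
      exact Real.rpow_le_rpow hy.1.le hy.2.le (by linarith [S.nonneg])
  exact (hcont.continuousAt (Ioo_mem_nhds hx (lt_add_one x))).continuousWithinAt

theorem isBigO_tsum_volterraIterate (S : FundamentalSystem ρ V u v u' v')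
    (hQ : Q ∈ PotentialClass 0) (hF : ContinuousOn F (Ioi 0))
    (hFO : F =O[𝓝[>] 0] fun x : ℝ => x ^ (1 / 2 + ρ)) :
    (fun x => ∑' j, volterraIterate u v Q F j x) =O[𝓝[>] 0] fun x : ℝ => x ^ (1 / 2 + ρ) := by
  obtain ⟨a, ha, hbound⟩ := S.exists_summable_norm_volterraIterate_le hQ hF hFO 1
  exact isBigO_rpow_of_forall_norm_le one_pos fun x hx =>
    tsum_of_norm_bounded (ha.hasSum.mul_right _) fun j => (hbound j).2 x hx

theorem exists_eq_sub_forwardOp (S : FundamentalSystem ρ V u v u' v')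
    (hQ : Q ∈ PotentialClass 0) (hF : ContinuousOn F (Ioi 0))
    (hFO : F =O[𝓝[>] 0] fun x : ℝ => x ^ (1 / 2 + ρ)) :
    ∃ r : ℝ → ℂ, ContinuousOn r (Ioi 0) ∧ (r =O[𝓝[>] 0] fun x : ℝ => x ^ (1 / 2 + ρ)) ∧
      ∀ x : ℝ, 0 < x → r x = F x - forwardOp u v (fun y => Q y * r y) x := by
  refine ⟨_, S.continuousOn_tsum_volterraIterate hQ hF hFO,
    S.isBigO_tsum_volterraIterate hQ hF hFO, fun x hx => ?_⟩
  obtain ⟨a, ha, hbound⟩ := S.exists_summable_norm_volterraIterate_le hQ hF hFO x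
  have hsum : Summable fun j => volterraIterate u v Q F j x :=
    .of_norm_bounded (ha.mul_right _) fun j => (hbound j).2 x ⟨hx, le_rfl⟩
  have hintegral := fun (w : ℝ → ℂ) hw hwO => hasSum_integral_mul_of_norm_le (w := w) hQ hw hwO
    (S.continuousOn_volterraIterate hQ hF hFO) ha (fun j => (hbound j).2) hx
  have hforward := ((hintegral u S.continuousOn_u S.isBigO_u_sub).mul_left (v x)).sub
    ((hintegral v S.continuousOn_v S.isBigO_v).mul_left (u x))
  rw [hsum.tsum_eq_zero_add, sub_eq_add_neg]
  exact congrArg (F x + ·) hforward.neg.tsum_eq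

theorem eq_zero_of_isLittleO (S : FundamentalSystem ρ V u v u' v') (hQ : Q ∈ PotentialClass 0)
    (hd : SolvesWith V (fun x => -(Q x * d x)) d D)
    (hdo : d =o[𝓝[>] 0] fun x : ℝ => x ^ (1 / 2 + ρ))
    (hDo : D =o[𝓝[>] 0] fun x : ℝ => x ^ (-1 / 2 + ρ)) {x : ℝ} (hx : 0 < x) : d x = 0 := by
  have hρ := S.nonneg
  have hQd := mul_mem_potentialClass hQ hd.continuousOn hdo.isBigO
  have hu : ∀ y : ℝ, 0 < y → u y * D y - u' y * d y = ∫ t in (0 : ℝ)..y, u t * (Q t * d t) :=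
    fun y hy => by
      simpa using S.solvesWith_u.wronskian_eq_neg_integral hd S.isBigO_u S.isBigO_deriv_u hdo hDo
        (by linarith) (by linarith)
        (fun X => by simpa using (S.integrableOn_u_mul (S.mem_potentialClass_sub hQd) X).neg) hy
  have hv : ∀ y : ℝ, 0 < y → v y * D y - v' y * d y = ∫ t in (0 : ℝ)..y, v t * (Q t * d t) :=
    fun y hy => by
      simpa using S.solvesWith_v.wronskian_eq_neg_integral hd S.isBigO_v S.isBigO_deriv_v hdo hDo
        (by linarith) (by linarith) (fun X => by simpa using (S.integrableOn_v_mul hQd X).neg) hy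
  have hvolterra : ∀ y : ℝ, 0 < y → d y = -forwardOp u v (fun t => Q t * d t) y := by
    intro y hy
    rw [forwardOp, ← hu y hy, ← hv y hy]
    linear_combination (-d y) * S.wronskian y hy
  obtain ⟨M, -, hM⟩ := exists_norm_le_rpow_of_isBigO hd.continuousOn hdo.isBigO (x + 1)
  exact S.eq_zero_of_eq_neg_forwardOp hQ
    (ae_restrict_of_forall_mem measurableSet_Ioo fun y hy => hM y ⟨hy.1, hy.2.le⟩)
    (fun y hy => hvolterra y hy.1) x ⟨hx, lt_add_one x⟩

theorem exists_correction (S : FundamentalSystem ρ V u v u' v') (hQ : Q ∈ PotentialClass 0)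
    (hq : q ∈ PotentialClass (1 / 2 + ρ)) (hT : SolvesWith V (fun x => -(Q x * T x) - q x) T DT) :
    ∃ r Dr : ℝ → ℂ,
      SolvesWith V (fun x => -(Q x * (T x + r x))) (fun x => T x + r x) (fun x => DT x + Dr x) ∧
      (r =o[𝓝[>] 0] fun x : ℝ => x ^ (1 / 2 + ρ)) ∧
      (Dr =o[𝓝[>] 0] fun x : ℝ => x ^ (-1 / 2 + ρ)) ∧ ContinuousOn r (Ioi 0) ∧
      ∀ x : ℝ, 0 < x → r x + forwardOp u v (fun y => Q y * r y) x = forwardOp u v q x := by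
  obtain ⟨DF, hF, hFo, hDFo⟩ := S.exists_solvesWith_forwardOp hq
  obtain ⟨r, hr, hrO, hrF⟩ := S.exists_eq_sub_forwardOp hQ hF.continuousOn hFo.isBigO
  obtain ⟨DG, hG, hGo, hDGo⟩ := S.exists_solvesWith_forwardOp (mul_mem_potentialClass hQ hr hrO)
  refine ⟨r, fun x => DF x + -1 * DG x, ?_, ?_, hDFo.add (hDGo.const_mul_left (-1)), hr,
    fun x hx => by rw [hrF x hx, sub_add_cancel]⟩
  · refine (hT.add (hF.add (hG.const_mul (-1)))).congr (fun x _ => ?_) (fun x hx => ?_)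
    · ring
    · simp only [hrF x hx]
      ring
  · refine (hFo.sub hGo).congr' ?_ .rfl
    filter_upwards [self_mem_nhdsWithin] with x hx
    exact (hrF x hx).symm

end FundamentalSystem

section ExponentialSeries

variable {c : ℕ → ℂ} {M : ℝ}

theorem norm_pow_mul_inv_factorial_mul_le {z : ℂ} (hz : ‖z‖ ≤ M) (w : ℂ) (n : ℕ) :
    ‖w ^ n * ((n.factorial : ℂ)⁻¹ * z)‖ ≤ ‖w‖ ^ n / n.factorial * M := by
  rw [norm_mul, norm_mul, norm_pow, norm_inv, Complex.norm_natCast, ← mul_assoc, ← div_eq_mul_inv]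
  exact mul_le_mul_of_nonneg_left hz (by positivity)

theorem summable_pow_mul_inv_factorial_mul (hc : ∀ n, ‖c n‖ ≤ M) (w : ℂ) :
    Summable fun n : ℕ => w ^ n * ((n.factorial : ℂ)⁻¹ * c n) :=
  .of_norm_bounded ((Real.summable_pow_div_factorial ‖w‖).mul_right M) fun n =>
    norm_pow_mul_inv_factorial_mul_le (hc n) w n

theorem hasDerivAt_pow_succ_mul_inv_factorial_mul (n : ℕ) (z w : ℂ) :
    HasDerivAt (fun w : ℂ => w ^ (n + 1) * (((n + 1).factorial : ℂ)⁻¹ * z))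
      (w ^ n * ((n.factorial : ℂ)⁻¹ * z)) w := by
  refine ((hasDerivAt_pow (n + 1) w).mul_const _).congr_deriv ?_
  have hn : ((n + 1 : ℕ) : ℂ) ≠ 0 := Nat.cast_ne_zero.2 n.succ_ne_zero
  rw [Nat.factorial_succ, Nat.add_sub_cancel, Nat.cast_mul, mul_inv]
  field_simp

theorem hasDerivAt_tsum_pow_mul_inv_factorial_mul (hc : ∀ n, ‖c n‖ ≤ M) (w : ℂ) :
    HasDerivAt (fun w : ℂ => ∑' n : ℕ, w ^ n * ((n.factorial : ℂ)⁻¹ * c n))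
      (∑' n : ℕ, w ^ n * ((n.factorial : ℂ)⁻¹ * c (n + 1))) w := by
  have hM : 0 ≤ M := (norm_nonneg _).trans (hc 0)
  have hsummable := fun w => (summable_nat_add_iff 1).2 (summable_pow_mul_inv_factorial_mul hc w)
  have hderiv := hasDerivAt_tsum_of_isPreconnected
    ((Real.summable_pow_div_factorial (‖w‖ + 1)).mul_right M) Metric.isOpen_ball
    (convex_ball (0 : ℂ) (‖w‖ + 1)).isPreconnected
    (fun n y _ => hasDerivAt_pow_succ_mul_inv_factorial_mul n (c (n + 1)) y)
    (fun n y hy => (norm_pow_mul_inv_factorial_mul_le (hc (n + 1)) y n).trans <| by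
      have := (mem_ball_zero_iff.1 hy).le
      gcongr)
    (Metric.mem_ball_self (by positivity)) (hsummable 0)
    (mem_ball_zero_iff.2 (lt_add_one ‖w‖))
  refine (hderiv.const_add (c 0)).congr_of_eventuallyEq (.of_forall fun y => ?_)
  simp [(summable_pow_mul_inv_factorial_mul hc y).tsum_eq_zero_add]

end ExponentialSeries

section RecipGamma

theorem norm_inv_Gamma_add_one_le {s : ℂ} (hs : 1 ≤ ‖s‖) :
    ‖(Complex.Gamma (s + 1))⁻¹‖ ≤ ‖(Complex.Gamma s)⁻¹‖ := by
  rw [Complex.one_div_Gamma_eq_self_mul_one_div_Gamma_add_one s, norm_mul]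
  exact le_mul_of_one_le_left (norm_nonneg _) hs

theorem exists_norm_inv_Gamma_le (R : ℝ) :
    ∃ M : ℝ, ∀ (n : ℕ) (m : ℂ), ‖m‖ ≤ R → ‖(Complex.Gamma (m + n + 1))⁻¹‖ ≤ M := by
  obtain ⟨N, hN⟩ := exists_nat_ge R
  obtain ⟨M, hM⟩ := (isCompact_closedBall (0 : ℂ) (R + N + 1)).exists_bound_of_continuousOn
    Complex.differentiable_one_div_Gamma.continuous.continuousOn
  refine ⟨M, fun n m hm => ?_⟩
  have hsmall : ∀ i ≤ N, ‖(Complex.Gamma (m + i + 1))⁻¹‖ ≤ M := fun i hi => by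
    refine hM _ (mem_closedBall_zero_iff.2 (norm_add₃_le.trans ?_))
    rw [Complex.norm_natCast, norm_one]
    have : (i : ℝ) ≤ N := Nat.cast_le.2 hi
    linarith
  induction n with
  | zero => exact hsmall 0 N.zero_le
  | succ n ih =>
    rcases le_or_gt (n + 1) N with hn | hn
    · exact hsmall (n + 1) hn
    · have hnorm : 1 ≤ ‖m + n + 1‖ := by
        have htriangle := norm_sub_le (m + n + 1) m
        rw [add_assoc, add_sub_cancel_left, ← Nat.cast_add_one, Complex.norm_natCast] at htriangle
        have : (N : ℝ) + 1 ≤ (n + 1 : ℕ) := by exact_mod_cast hn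
        rw [add_assoc, ← Nat.cast_add_one]
        linarith
      rw [Nat.cast_add_one, ← add_assoc m]
      exact (norm_inv_Gamma_add_one_le hnorm).trans ih

theorem exists_norm_deriv_inv_Gamma_le (R : ℝ) :
    ∃ M : ℝ, ∀ (n : ℕ) (m : ℂ), ‖m‖ ≤ R →
      ‖deriv (fun s => (Complex.Gamma s)⁻¹) (m + n + 1)‖ ≤ M := by
  obtain ⟨M, hM⟩ := exists_norm_inv_Gamma_le (R + 1)
  refine ⟨M, fun n m hm => ?_⟩
  have hsphere : ∀ z ∈ Metric.sphere (m + n + 1) 1, ‖(Complex.Gamma z)⁻¹‖ ≤ M := by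
    intro z hz
    have hz' : ‖z - n - 1‖ ≤ R + 1 := by
      calc ‖z - n - 1‖ = ‖z - (m + n + 1) + m‖ := by congr 1; ring
        _ ≤ ‖z - (m + n + 1)‖ + ‖m‖ := norm_add_le _ _
        _ ≤ R + 1 := by rw [mem_sphere_iff_norm.1 hz]; linarith
    have hbound := hM n (z - n - 1) hz'
    rwa [show z - n - 1 + n + 1 = z by ring] at hbound
  simpa using Complex.norm_deriv_le_of_forall_mem_sphere_norm_le one_pos
    Complex.differentiable_one_div_Gamma.diffContOnCl hsphere

theorem inv_Gamma_mul_inv_Gamma_neg (m : ℂ) :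
    m * ((Complex.Gamma (-m + 1))⁻¹ * (Complex.Gamma (m + 1))⁻¹) =
      Complex.sin (Real.pi * m) / Real.pi := by
  have hreflection := congrArg (·⁻¹) (Complex.Gamma_mul_Gamma_one_sub m)
  simp only [mul_inv, inv_div,
    Complex.one_div_Gamma_eq_self_mul_one_div_Gamma_add_one m] at hreflection
  rw [← hreflection, neg_add_eq_sub]
  ring

end RecipGamma

section HypF

/-- The derivative of `hypF` with respect to the order. -/
noncomputable def hypFOrder (m w : ℂ) : ℂ :=
  ∑' n : ℕ, w ^ n * ((n.factorial : ℂ)⁻¹ * deriv (fun s => (Complex.Gamma s)⁻¹) (m + n + 1))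

theorem hypF_eq_tsum (m w : ℂ) :
    hypF m w = ∑' n : ℕ, w ^ n * ((n.factorial : ℂ)⁻¹ * (Complex.Gamma (m + n + 1))⁻¹) := by
  simp only [hypF, mul_inv]

theorem summable_hypF (m w : ℂ) :
    Summable fun n : ℕ => w ^ n * ((n.factorial : ℂ)⁻¹ * (Complex.Gamma (m + n + 1))⁻¹) := by
  obtain ⟨M, hM⟩ := exists_norm_inv_Gamma_le ‖m‖
  exact summable_pow_mul_inv_factorial_mul (fun n => hM n m le_rfl) w

theorem hasDerivAt_hypF (m w : ℂ) : HasDerivAt (hypF m) (hypF (m + 1) w) w := by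
  obtain ⟨M, hM⟩ := exists_norm_inv_Gamma_le ‖m‖
  rw [funext (hypF_eq_tsum m), hypF_eq_tsum]
  convert hasDerivAt_tsum_pow_mul_inv_factorial_mul (fun n => hM n m le_rfl) w using 6 with n
  rw [Nat.cast_add_one, add_right_comm m, add_assoc m]

theorem hasDerivAt_hypFOrder (m w : ℂ) : HasDerivAt (hypFOrder m) (hypFOrder (m + 1) w) w := by
  obtain ⟨M, hM⟩ := exists_norm_deriv_inv_Gamma_le ‖m‖
  unfold hypFOrder
  convert hasDerivAt_tsum_pow_mul_inv_factorial_mul (fun n => hM n m le_rfl) w using 6 with n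
  rw [Nat.cast_add_one, add_right_comm m, add_assoc m]

theorem hasDerivAt_hypF_order (m w : ℂ) : HasDerivAt (fun m => hypF m w) (hypFOrder m w) m := by
  obtain ⟨M, hM⟩ := exists_norm_deriv_inv_Gamma_le (‖m‖ + 1)
  simp only [hypF_eq_tsum]
  refine hasDerivAt_tsum_of_isPreconnected
    ((Real.summable_pow_div_factorial ‖w‖).mul_right M) Metric.isOpen_ball
    (convex_ball (0 : ℂ) (‖m‖ + 1)).isPreconnected (fun n y _ => ?_)
    (fun n y hy => norm_pow_mul_inv_factorial_mul_le (hM n y (mem_ball_zero_iff.1 hy).le) w n)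
    (Metric.mem_ball_self (by positivity)) (summable_hypF 0 w)
    (mem_ball_zero_iff.2 (lt_add_one ‖m‖))
  have hGamma := (Complex.differentiable_one_div_Gamma (y + n + 1)).hasDerivAt
  rw [add_assoc] at hGamma ⊢
  simpa only [add_assoc] using ((hGamma.comp_add_const y _).const_mul _).const_mul _

theorem hypF_recurrence (m w : ℂ) :
    hypF m w = (m + 1) * hypF (m + 1) w + w * hypF (m + 2) w := by
  set g : ℕ → ℂ := fun n =>
    (n : ℂ) * (w ^ n * ((n.factorial : ℂ)⁻¹ * (Complex.Gamma (m + 1 + n + 1))⁻¹)) with hg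
  have hg_succ : ∀ n : ℕ, g (n + 1) =
      w * (w ^ n * ((n.factorial : ℂ)⁻¹ * (Complex.Gamma (m + 2 + n + 1))⁻¹)) := by
    intro n
    have hn : (n : ℂ) + 1 ≠ 0 := Nat.cast_add_one_ne_zero n
    simp only [hg]
    rw [Nat.factorial_succ, show m + 1 + ((n + 1 : ℕ) : ℂ) + 1 = m + 2 + n + 1 by push_cast; ring]
    push_cast
    field_simp
    ring
  have hg_summable : Summable g := by
    rw [← summable_nat_add_iff 1]
    simpa only [hg_succ] using (summable_hypF (m + 2) w).mul_left w
  have hg_tsum : ∑' n, g n = w * hypF (m + 2) w := by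
    rw [hg_summable.tsum_eq_zero_add, hypF_eq_tsum, ← tsum_mul_left]
    simp only [hg_succ]
    simp [hg]
  rw [← hg_tsum, hypF_eq_tsum (m + 1), ← tsum_mul_left,
    ← ((summable_hypF (m + 1) w).mul_left _).tsum_add hg_summable, hypF_eq_tsum]
  refine tsum_congr fun n => ?_
  rw [Complex.one_div_Gamma_eq_self_mul_one_div_Gamma_add_one (m + n + 1), hg,
    show m + n + 1 + 1 = m + 1 + n + 1 by ring]
  ring

theorem hypF_zero (m : ℂ) : hypF m 0 = (Complex.Gamma (m + 1))⁻¹ := by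
  rw [hypF_eq_tsum, tsum_eq_single 0 (fun n hn => by simp [hn])]
  simp

theorem hypF_neg_natCast (N : ℕ) (w : ℂ) : hypF (-N) w = w ^ N * hypF N w := by
  rw [hypF_eq_tsum, ← (summable_hypF (-N) w).sum_add_tsum_nat_add N, Finset.sum_eq_zero, zero_add,
    hypF_eq_tsum, ← tsum_mul_left]
  · refine tsum_congr fun i => ?_
    rw [show -(N : ℂ) + ((i + N : ℕ) : ℂ) + 1 = (i : ℂ) + 1 by push_cast; ring,
      show (N : ℂ) + i + 1 = ((i + N : ℕ) : ℂ) + 1 by push_cast; ring,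
      Complex.Gamma_nat_eq_factorial, Complex.Gamma_nat_eq_factorial]
    ring
  · intro n hn
    obtain ⟨j, rfl⟩ := Nat.exists_eq_add_of_lt (Finset.mem_range.1 hn)
    rw [show -((n + j + 1 : ℕ) : ℂ) + n + 1 = -(j : ℂ) by push_cast; ring,
      Complex.Gamma_neg_nat_eq_zero]
    simp

theorem hasDerivAt_hypF_wronskian (m w : ℂ) :
    HasDerivAt (fun w => 2 * m * (hypF (-m) w * hypF m w) +
      2 * w * (hypF (-m) w * hypF (m + 1) w - hypF (-m + 1) w * hypF m w)) 0 w := by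
  refine ((((hasDerivAt_hypF (-m) w).mul (hasDerivAt_hypF m w)).const_mul (2 * m)).add
    (((hasDerivAt_id w).const_mul 2).mul
      (((hasDerivAt_hypF (-m) w).mul (hasDerivAt_hypF (m + 1) w)).sub
        ((hasDerivAt_hypF (-m + 1) w).mul (hasDerivAt_hypF m w))))).congr_deriv ?_
  simp only [id, Pi.mul_apply, Pi.sub_apply]
  rw [show m + 1 + 1 = m + 2 by ring, show -m + 1 + 1 = -m + 2 by ring]
  linear_combination (-2 * hypF (-m) w) * hypF_recurrence m w +
    2 * hypF m w * hypF_recurrence (-m) w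

theorem hypF_wronskian (m w : ℂ) :
    2 * m * (hypF (-m) w * hypF m w) +
      2 * w * (hypF (-m) w * hypF (m + 1) w - hypF (-m + 1) w * hypF m w) =
      2 * Complex.sin (Real.pi * m) / Real.pi := by
  have hconst := is_const_of_deriv_eq_zero
    (fun w => (hasDerivAt_hypF_wronskian m w).differentiableAt)
    (fun w => (hasDerivAt_hypF_wronskian m w).deriv) w 0
  rw [hconst, hypF_zero, hypF_zero]
  linear_combination 2 * inv_Gamma_mul_inv_Gamma_neg m

end HypF

section UnperturbedSolutions

theorem ofReal_ne_zero_of_pos {x : ℝ} (hx : 0 < x) : (x : ℂ) ≠ 0 :=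
  Complex.ofReal_ne_zero.2 hx.ne'

theorem hasDerivAt_ofReal_cpow (s : ℂ) {x : ℝ} (hx : 0 < x) :
    HasDerivAt (fun x : ℝ => (x : ℂ) ^ s) (s / x * (x : ℂ) ^ s) x := by
  refine ((hasDerivAt_id (x : ℂ)).cpow_const (c := s)
    (Complex.ofReal_mem_slitPlane.2 hx)).comp_ofReal.congr_deriv ?_
  rw [mul_one, id, Complex.cpow_sub _ _ (ofReal_ne_zero_of_pos hx), Complex.cpow_one]
  ring

theorem hasDerivAt_const_div_ofReal (a : ℂ) {x : ℝ} (hx : 0 < x) :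
    HasDerivAt (fun x : ℝ => a / (x : ℂ)) (-a / (x : ℂ) ^ 2) x := by
  refine ((hasDerivAt_inv (ofReal_ne_zero_of_pos hx)).const_mul a).comp_ofReal.congr_deriv ?_
  ring

theorem hasDerivAt_comp_sq (k : ℂ) {f : ℂ → ℂ} {f' : ℂ} {x : ℝ}
    (hf : HasDerivAt f f' (k ^ 2 * (x : ℂ) ^ 2 / 4)) :
    HasDerivAt (fun x : ℝ => f (k ^ 2 * (x : ℂ) ^ 2 / 4)) (f' * (k ^ 2 / 2 * x)) x := by
  have hsq : HasDerivAt (fun z : ℂ => k ^ 2 * z ^ 2 / 4) (k ^ 2 / 2 * x) (x : ℂ) := by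
    refine (((hasDerivAt_pow 2 (x : ℂ)).const_mul (k ^ 2)).div_const 4).congr_deriv ?_
    push_cast
    ring
  exact (hf.comp (x : ℂ) hsq).comp_ofReal

theorem cpow_half_add_add_one {x : ℝ} (hx : 0 < x) (m : ℂ) :
    (x : ℂ) ^ (1 / 2 + (m + 1)) = (x : ℂ) ^ (1 / 2 + m) * x := by
  rw [← add_assoc, Complex.cpow_add _ _ (ofReal_ne_zero_of_pos hx), Complex.cpow_one]

theorem cpow_half_add_neg_mul_cpow_half_add {x : ℝ} (hx : 0 < x) (m : ℂ) :
    (x : ℂ) ^ (1 / 2 + -m) * (x : ℂ) ^ (1 / 2 + m) = x := by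
  rw [← Complex.cpow_add _ _ (ofReal_ne_zero_of_pos hx),
    show (1 / 2 + -m) + (1 / 2 + m) = (1 : ℂ) by ring, Complex.cpow_one]

/-- The potential of the unperturbed equation `f'' = ((m² - 1/4)/x² + k²) f`. -/
noncomputable def freePotential (m k : ℂ) (x : ℝ) : ℂ := (m ^ 2 - 1 / 4) / (x : ℂ) ^ 2 + k ^ 2

theorem continuousOn_freePotential (m k : ℂ) : ContinuousOn (freePotential m k) (Ioi 0) :=
  (continuousOn_const.div (by fun_prop)
    fun _ hx => pow_ne_zero 2 (ofReal_ne_zero_of_pos hx)).add continuousOn_const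

theorem freePotential_neg (m k : ℂ) : freePotential (-m) k = freePotential m k := by
  funext x
  simp only [freePotential, neg_sq]

/-- The derivative of `u⁰_m(x,k)` with respect to `x`. -/
noncomputable def u0Deriv (m k : ℂ) (x : ℝ) : ℂ :=
  (1 / 2 + m) / x * u0 m k x + k ^ 2 / 2 * u0 (m + 1) k x

/-- The derivative of `u⁰_m(x,k)` with respect to the order `m`. -/
noncomputable def u0Order (m k : ℂ) (x : ℝ) : ℂ :=
  Complex.log x * u0 m k x + (x : ℂ) ^ (1 / 2 + m) * hypFOrder m (k ^ 2 * (x : ℂ) ^ 2 / 4)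

/-- The mixed derivative of `u⁰_m(x,k)` with respect to `x` and to the order `m`. -/
noncomputable def u0OrderDeriv (m k : ℂ) (x : ℝ) : ℂ :=
  (1 / 2 + m) / x * u0Order m k x + 1 / x * u0 m k x + k ^ 2 / 2 * u0Order (m + 1) k x

theorem hasDerivAt_u0 (m k : ℂ) {x : ℝ} (hx : 0 < x) : HasDerivAt (u0 m k) (u0Deriv m k x) x := by
  refine ((hasDerivAt_ofReal_cpow (1 / 2 + m) hx).mul
    (hasDerivAt_comp_sq k (hasDerivAt_hypF m _))).congr_deriv ?_
  simp only [u0Deriv, u0, cpow_half_add_add_one hx]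
  ring

theorem hasDerivAt_u0Order (m k : ℂ) {x : ℝ} (hx : 0 < x) :
    HasDerivAt (u0Order m k) (u0OrderDeriv m k x) x := by
  have hlog : HasDerivAt (fun x : ℝ => Complex.log x) ((x : ℂ)⁻¹) x :=
    (Complex.hasDerivAt_log (Complex.ofReal_mem_slitPlane.2 hx)).comp_ofReal
  refine ((hlog.mul (hasDerivAt_u0 m k hx)).add ((hasDerivAt_ofReal_cpow (1 / 2 + m) hx).mul
    (hasDerivAt_comp_sq k (hasDerivAt_hypFOrder m _)))).congr_deriv ?_
  simp only [u0OrderDeriv, u0Order, u0Deriv, cpow_half_add_add_one hx]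
  ring

theorem hasDerivAt_u0_order (m k : ℂ) {x : ℝ} (hx : 0 < x) :
    HasDerivAt (fun m => u0 m k x) (u0Order m k x) m := by
  have hpow : HasDerivAt (fun m : ℂ => (x : ℂ) ^ (1 / 2 + m))
      ((x : ℂ) ^ (1 / 2 + m) * Complex.log x * 1) m :=
    ((hasDerivAt_id m).const_add (1 / 2)).const_cpow (.inl (ofReal_ne_zero_of_pos hx))
  refine (hpow.mul (hasDerivAt_hypF_order m _)).congr_deriv ?_
  simp only [u0Order, u0]
  ring

theorem hasDerivAt_u0Deriv_order (m k : ℂ) {x : ℝ} (hx : 0 < x) :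
    HasDerivAt (fun m => u0Deriv m k x) (u0OrderDeriv m k x) m := by
  refine ((((hasDerivAt_id m).const_add (1 / 2)).div_const (x : ℂ)).mul
    (hasDerivAt_u0_order m k hx)).add
    (((hasDerivAt_u0_order (m + 1) k hx).comp_add_const m 1).const_mul (k ^ 2 / 2))
    |>.congr_deriv ?_
  simp only [u0OrderDeriv, id]
  ring

theorem u0_recurrence (m k : ℂ) {x : ℝ} (hx : 0 < x) :
    u0 m k x = (m + 1) / x * u0 (m + 1) k x + k ^ 2 / 4 * u0 (m + 1 + 1) k x := by
  have hx0 := ofReal_ne_zero_of_pos hx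
  simp only [u0, cpow_half_add_add_one hx]
  rw [hypF_recurrence m, add_assoc m, one_add_one_eq_two]
  field_simp

theorem u0Order_recurrence (m k : ℂ) {x : ℝ} (hx : 0 < x) :
    u0Order m k x = 1 / x * u0 (m + 1) k x + (m + 1) / x * u0Order (m + 1) k x +
      k ^ 2 / 4 * u0Order (m + 1 + 1) k x := by
  have hshift := (hasDerivAt_u0_order (m + 1 + 1) k hx).comp_add_const (m + 1) 1
  have hrhs := ((((hasDerivAt_id m).add_const 1).div_const (x : ℂ)).mul
    ((hasDerivAt_u0_order (m + 1) k hx).comp_add_const m 1)).add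
    ((hshift.comp_add_const m 1).const_mul (k ^ 2 / 4))
  exact (hasDerivAt_u0_order m k hx).unique
    (hrhs.congr_of_eventuallyEq (.of_forall fun m => u0_recurrence m k hx))

theorem hasDerivAt_u0Deriv (m k : ℂ) {x : ℝ} (hx : 0 < x) :
    HasDerivAt (u0Deriv m k) (freePotential m k x * u0 m k x) x := by
  refine (((hasDerivAt_const_div_ofReal (1 / 2 + m) hx).mul (hasDerivAt_u0 m k hx)).add
    ((hasDerivAt_u0 (m + 1) k hx).const_mul (k ^ 2 / 2))).congr_deriv ?_
  simp only [u0Deriv, freePotential]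
  linear_combination (-k ^ 2) * u0_recurrence m k hx

theorem hasDerivAt_u0OrderDeriv (m k : ℂ) {x : ℝ} (hx : 0 < x) :
    HasDerivAt (u0OrderDeriv m k)
      (freePotential m k x * u0Order m k x + 2 * m / (x : ℂ) ^ 2 * u0 m k x) x := by
  refine ((((hasDerivAt_const_div_ofReal (1 / 2 + m) hx).mul (hasDerivAt_u0Order m k hx)).add
    ((hasDerivAt_const_div_ofReal 1 hx).mul (hasDerivAt_u0 m k hx))).add
    ((hasDerivAt_u0Order (m + 1) k hx).const_mul (k ^ 2 / 2))).congr_deriv ?_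
  simp only [u0OrderDeriv, u0Deriv, freePotential]
  linear_combination (-k ^ 2) * u0Order_recurrence m k hx

theorem u0_wronskian (m k : ℂ) {x : ℝ} (hx : 0 < x) :
    u0 (-m) k x * u0Deriv m k x - u0Deriv (-m) k x * u0 m k x =
      2 * Complex.sin (Real.pi * m) / Real.pi := by
  have hcpow := cpow_half_add_neg_mul_cpow_half_add hx m
  have hcpow_div : (x : ℂ) ^ (1 / 2 + -m) * (x : ℂ) ^ (1 / 2 + m) / x = 1 := by
    rw [hcpow, div_self (ofReal_ne_zero_of_pos hx)]
  rw [← hypF_wronskian m (k ^ 2 * (x : ℂ) ^ 2 / 4)]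
  simp only [u0Deriv, u0, cpow_half_add_add_one hx]
  set w := k ^ 2 * (x : ℂ) ^ 2 / 4
  have hw : 2 * w = k ^ 2 / 2 * x * x := by ring
  rw [hw]
  linear_combination (2 * m * (hypF (-m) w * hypF m w)) * hcpow_div +
    (k ^ 2 / 2 * x * (hypF (-m) w * hypF (m + 1) w - hypF (-m + 1) w * hypF m w)) * hcpow

theorem u0_neg_natCast (N : ℕ) (k : ℂ) {x : ℝ} (hx : 0 < x) :
    u0 (-N) k x = (k / 2) ^ (2 * (N : ℂ)) * u0 N k x := by
  have hcpow : (x : ℂ) ^ (1 / 2 + (N : ℂ)) =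
      (x : ℂ) ^ (1 / 2 + -(N : ℂ)) * (x : ℂ) ^ (2 * N) := by
    rw [← Complex.cpow_natCast (x : ℂ) (2 * N), ← Complex.cpow_add _ _ (ofReal_ne_zero_of_pos hx)]
    congr 1
    push_cast
    ring
  rw [← Nat.cast_ofNat, ← Nat.cast_mul, Complex.cpow_natCast]
  simp only [u0, hypF_neg_natCast]
  rw [hcpow, show k ^ 2 * (x : ℂ) ^ 2 / 4 = (k / 2) ^ 2 * (x : ℂ) ^ 2 by ring, mul_pow, ← pow_mul,
    ← pow_mul]
  ring

theorem isBigO_ofReal_cpow (m : ℂ) :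
    (fun x : ℝ => (x : ℂ) ^ m) =O[𝓝[>] 0] fun x : ℝ => x ^ m.re := by
  refine IsBigO.of_norm_eventuallyLE ?_
  filter_upwards [self_mem_nhdsWithin] with x hx
  rw [Complex.norm_cpow_eq_rpow_re_of_pos hx]

theorem isBigO_const_div_ofReal (a : ℂ) :
    (fun x : ℝ => a / (x : ℂ)) =O[𝓝[>] 0] fun x : ℝ => x ^ (-1 : ℝ) := by
  simpa only [Complex.cpow_neg_one, div_eq_mul_inv, Complex.neg_re, Complex.one_re] using
    (isBigO_ofReal_cpow (-1)).const_mul_left a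

theorem isBigO_log_ofReal :
    (fun x : ℝ => Complex.log x) =O[𝓝[>] 0] fun x : ℝ => x ^ (-1 : ℝ) := by
  refine IsBigO.trans (IsBigO.of_norm_eventuallyLE (g := fun x : ℝ => ‖Real.log x‖) ?_)
    (isLittleO_log_rpow_nhdsGT_zero neg_one_lt_zero).isBigO.norm_left
  filter_upwards [self_mem_nhdsWithin] with x hx
  rw [← Complex.ofReal_log (le_of_lt hx), Complex.norm_real]

theorem isBigO_comp_sq (k : ℂ) {F : ℂ → ℂ} (hF : ContinuousAt F 0) :
    (fun x : ℝ => F (k ^ 2 * (x : ℂ) ^ 2 / 4)) =O[𝓝[>] 0] fun x : ℝ => x ^ (0 : ℝ) := by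
  have hsq : Continuous fun x : ℝ => k ^ 2 * (x : ℂ) ^ 2 / 4 := by fun_prop
  have htendsto : Tendsto (fun x : ℝ => F (k ^ 2 * (x : ℂ) ^ 2 / 4)) (𝓝 0) (𝓝 (F 0)) :=
    hF.tendsto.comp (by simpa using hsq.tendsto 0)
  simpa only [Real.rpow_zero] using (htendsto.mono_left nhdsWithin_le_nhds).isBigO_one ℝ

theorem isBigO_u0 (m k : ℂ) : u0 m k =O[𝓝[>] 0] fun x : ℝ => x ^ (1 / 2 + m.re) :=
  isBigO_mul_rpow (isBigO_ofReal_cpow _)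
    (isBigO_comp_sq k (hasDerivAt_hypF m 0).continuousAt) (by simp)

theorem isBigO_u0Deriv (m k : ℂ) : u0Deriv m k =O[𝓝[>] 0] fun x : ℝ => x ^ (-1 / 2 + m.re) :=
  (isBigO_mul_rpow (isBigO_const_div_ofReal _) (isBigO_u0 m k) (by linarith)).add
    (((isBigO_u0 (m + 1) k).trans
      (isBigO_rpow_rpow (by rw [Complex.add_re, Complex.one_re]; linarith))).const_mul_left _)

theorem isBigO_u0Order {m k : ℂ} {s t : ℝ} (hu : u0 m k =O[𝓝[>] 0] fun x : ℝ => x ^ s)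
    (hts : t ≤ s - 1) (htm : t ≤ 1 / 2 + m.re) :
    u0Order m k =O[𝓝[>] 0] fun x : ℝ => x ^ t :=
  (isBigO_mul_rpow isBigO_log_ofReal hu (by linarith)).add
    (isBigO_mul_rpow (isBigO_ofReal_cpow _)
      (isBigO_comp_sq k (hasDerivAt_hypFOrder m 0).continuousAt) (by simpa using htm))

theorem isBigO_u0OrderDeriv {m k : ℂ} {s t : ℝ} (hu : u0 m k =O[𝓝[>] 0] fun x : ℝ => x ^ s)
    (hts : t ≤ s - 2) (htm : t ≤ -1 / 2 + m.re) :
    u0OrderDeriv m k =O[𝓝[>] 0] fun x : ℝ => x ^ t := by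
  have hm : (m + 1).re = m.re + 1 := by rw [Complex.add_re, Complex.one_re]
  refine ((isBigO_mul_rpow (isBigO_const_div_ofReal _)
    (isBigO_u0Order (t := t + 1) hu (by linarith) (by linarith)) (by linarith)).add
    (isBigO_mul_rpow (isBigO_const_div_ofReal _) hu (by linarith))).add ?_
  exact (isBigO_u0Order (isBigO_u0 (m + 1) k) (by linarith) (by linarith)).const_mul_left _

end UnperturbedSolutions

section Macdonald

/-- The numerator `u⁰_{-m} - (k/2)^{2m} u⁰_m` in the definition of the Macdonald function. -/
noncomputable def macdonaldNum (m k : ℂ) (x : ℝ) : ℂ :=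
  u0 (-m) k x - (k / 2) ^ (2 * m) * u0 m k x

/-- The derivative of `macdonaldNum` with respect to `x`. -/
noncomputable def macdonaldNumDeriv (m k : ℂ) (x : ℝ) : ℂ :=
  u0Deriv (-m) k x - (k / 2) ^ (2 * m) * u0Deriv m k x

/-- The derivative of `macdonaldNum` with respect to the order `m`. -/
noncomputable def macdonaldNumOrder (m k : ℂ) (x : ℝ) : ℂ :=
  -u0Order (-m) k x -
    (k / 2) ^ (2 * m) * (2 * Complex.log (k / 2) * u0 m k x + u0Order m k x)

/-- The mixed derivative of `macdonaldNum` with respect to `x` and to the order `m`. -/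
noncomputable def macdonaldNumOrderDeriv (m k : ℂ) (x : ℝ) : ℂ :=
  -u0OrderDeriv (-m) k x -
    (k / 2) ^ (2 * m) * (2 * Complex.log (k / 2) * u0Deriv m k x + u0OrderDeriv m k x)

theorem hasDerivAt_macdonaldNum (m k : ℂ) {x : ℝ} (hx : 0 < x) :
    HasDerivAt (macdonaldNum m k) (macdonaldNumDeriv m k x) x :=
  (hasDerivAt_u0 (-m) k hx).sub ((hasDerivAt_u0 m k hx).const_mul _)

theorem hasDerivAt_macdonaldNumDeriv (m k : ℂ) {x : ℝ} (hx : 0 < x) :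
    HasDerivAt (macdonaldNumDeriv m k) (freePotential m k x * macdonaldNum m k x) x := by
  refine ((hasDerivAt_u0Deriv (-m) k hx).sub
    ((hasDerivAt_u0Deriv m k hx).const_mul _)).congr_deriv ?_
  rw [freePotential_neg, macdonaldNum]
  ring

theorem hasDerivAt_macdonaldNumOrder (m k : ℂ) {x : ℝ} (hx : 0 < x) :
    HasDerivAt (macdonaldNumOrder m k) (macdonaldNumOrderDeriv m k x) x :=
  (hasDerivAt_u0Order (-m) k hx).neg.sub
    ((((hasDerivAt_u0 m k hx).const_mul _).add (hasDerivAt_u0Order m k hx)).const_mul _)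

theorem hasDerivAt_macdonaldNumOrderDeriv (m k : ℂ) {x : ℝ} (hx : 0 < x) :
    HasDerivAt (macdonaldNumOrderDeriv m k)
      (freePotential m k x * macdonaldNumOrder m k x +
        2 * m / (x : ℂ) ^ 2 * macdonaldNum m k x) x := by
  refine ((hasDerivAt_u0OrderDeriv (-m) k hx).neg.sub
    ((((hasDerivAt_u0Deriv m k hx).const_mul _).add
      (hasDerivAt_u0OrderDeriv m k hx)).const_mul _)).congr_deriv ?_
  rw [freePotential_neg, macdonaldNum, macdonaldNumOrder]
  ring

theorem hasDerivAt_half_cpow_two_mul {k : ℂ} (hk : k ≠ 0) (m : ℂ) :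
    HasDerivAt (fun m : ℂ => (k / 2) ^ (2 * m))
      ((k / 2) ^ (2 * m) * Complex.log (k / 2) * (2 * 1)) m :=
  ((hasDerivAt_id m).const_mul 2).const_cpow (.inl (div_ne_zero hk two_ne_zero))

theorem hasDerivAt_macdonaldNum_order (m : ℂ) {k : ℂ} (hk : k ≠ 0) {x : ℝ} (hx : 0 < x) :
    HasDerivAt (fun m => macdonaldNum m k x) (macdonaldNumOrder m k x) m := by
  refine (((hasDerivAt_u0_order (-m) k hx).comp m (hasDerivAt_neg m)).sub
    ((hasDerivAt_half_cpow_two_mul hk m).mul (hasDerivAt_u0_order m k hx))).congr_deriv ?_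
  rw [macdonaldNumOrder]
  ring

theorem hasDerivAt_macdonaldNumDeriv_order (m : ℂ) {k : ℂ} (hk : k ≠ 0) {x : ℝ} (hx : 0 < x) :
    HasDerivAt (fun m => macdonaldNumDeriv m k x) (macdonaldNumOrderDeriv m k x) m := by
  refine (((hasDerivAt_u0Deriv_order (-m) k hx).comp m (hasDerivAt_neg m)).sub
    ((hasDerivAt_half_cpow_two_mul hk m).mul (hasDerivAt_u0Deriv_order m k hx))).congr_deriv ?_
  rw [macdonaldNumOrderDeriv]
  ring

theorem macdonaldNum_wronskian (m k : ℂ) {x : ℝ} (hx : 0 < x) :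
    macdonaldNum m k x * u0Deriv m k x - macdonaldNumDeriv m k x * u0 m k x =
      2 * Complex.sin (Real.pi * m) / Real.pi := by
  rw [← u0_wronskian m k hx, macdonaldNum, macdonaldNumDeriv]
  ring

theorem macdonaldNum_natCast (N : ℕ) (k : ℂ) {x : ℝ} (hx : 0 < x) : macdonaldNum N k x = 0 :=
  sub_eq_zero.2 (u0_neg_natCast N k hx)

theorem macdonaldNumDeriv_natCast (N : ℕ) (k : ℂ) {x : ℝ} (hx : 0 < x) :
    macdonaldNumDeriv N k x = 0 :=
  (hasDerivAt_macdonaldNum N k hx).unique <| (hasDerivAt_const x 0).congr_of_eventuallyEq <| by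
    filter_upwards [Ioi_mem_nhds hx] with y hy using macdonaldNum_natCast N k hy

theorem hasDerivAt_sin_pi_mul (m : ℂ) :
    HasDerivAt (fun m : ℂ => Complex.sin (Real.pi * m))
      (Complex.cos (Real.pi * m) * (Real.pi * 1)) m :=
  ((hasDerivAt_id m).const_mul (Real.pi : ℂ)).csin

theorem macdonaldNumOrder_wronskian_natCast (N : ℕ) {k : ℂ} (hk : k ≠ 0) {x : ℝ} (hx : 0 < x) :
    macdonaldNumOrder N k x * u0Deriv N k x - macdonaldNumOrderDeriv N k x * u0 N k x =
      2 * Complex.cos (Real.pi * N) := by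
  have hpi : (Real.pi : ℂ) ≠ 0 := Complex.ofReal_ne_zero.2 Real.pi_ne_zero
  have hlhs := ((hasDerivAt_macdonaldNum_order N hk hx).mul
    (hasDerivAt_u0Deriv_order N k hx)).sub
    ((hasDerivAt_macdonaldNumDeriv_order N hk hx).mul (hasDerivAt_u0_order N k hx))
  have hrhs := ((hasDerivAt_sin_pi_mul N).const_mul 2).div_const (Real.pi : ℂ)
  have hderiv := hlhs.unique <| hrhs.congr_of_eventuallyEq <|
    .of_forall fun m => macdonaldNum_wronskian m k hx
  rw [macdonaldNum_natCast N k hx, macdonaldNumDeriv_natCast N k hx] at hderiv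
  rw [zero_mul, zero_mul, add_zero, add_zero] at hderiv
  rw [hderiv]
  field_simp

theorem cos_pi_mul_natCast_ne_zero (N : ℕ) : Complex.cos (Real.pi * N) ≠ 0 := by
  have hcos : Real.cos (Real.pi * N) ≠ 0 := by
    rw [mul_comm, Real.cos_nat_mul_pi]
    exact pow_ne_zero _ (neg_ne_zero.2 one_ne_zero)
  exact_mod_cast hcos

theorem v0_natCast (N : ℕ) {k : ℂ} (hk : k ≠ 0) {x : ℝ} (hx : 0 < x) :
    v0 N k x = (2 * Complex.cos (Real.pi * N))⁻¹ * macdonaldNumOrder N k x := by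
  have hpi : (Real.pi : ℂ) ≠ 0 := Complex.ofReal_ne_zero.2 Real.pi_ne_zero
  have hcos := cos_pi_mul_natCast_ne_zero N
  have hsin : Complex.sin (Real.pi * N) = 0 := by rw [mul_comm, Complex.sin_nat_mul_pi]
  have hslope := ((hasDerivAt_iff_tendsto_slope.1 (hasDerivAt_macdonaldNum_order N hk hx)).div
    (hasDerivAt_iff_tendsto_slope.1 (hasDerivAt_sin_pi_mul N))
    (mul_ne_zero hcos (by simp))).const_mul ((Real.pi : ℂ) / 2)
  have hint : ∃ M : ℤ, (N : ℂ) = M := ⟨N, by simp⟩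
  rw [v0, if_neg hk, if_pos hint]
  refine Tendsto.limUnder_eq ?_
  convert hslope.congr' ?_ using 2
  · field_simp
  · filter_upwards [self_mem_nhdsWithin] with m hm
    simp only [Pi.div_apply, slope_def_field, hsin, macdonaldNum_natCast N k hx, sub_zero, v0NonInt,
      div_div_div_cancel_right₀ (sub_ne_zero.2 hm)]
    rw [macdonaldNum]
    ring

theorem isBigO_u0_neg_natCast (N : ℕ) (k : ℂ) :
    u0 (-N) k =O[𝓝[>] 0] fun x : ℝ => x ^ (1 / 2 + (N : ℝ)) := by
  refine ((isBigO_u0 N k).const_mul_left ((k / 2) ^ (2 * (N : ℂ)))).congr' ?_ ?_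
  · filter_upwards [self_mem_nhdsWithin] with x hx using (u0_neg_natCast N k hx).symm
  · rw [Complex.natCast_re]

theorem isBigO_macdonaldNumOrder_natCast {N : ℕ} (hN : 1 ≤ N) (k : ℂ) :
    macdonaldNumOrder N k =O[𝓝[>] 0] fun x : ℝ => x ^ (1 / 2 - (N : ℝ)) := by
  have hN' : (1 : ℝ) ≤ N := Nat.one_le_cast.2 hN
  have hu := isBigO_u0 N k
  rw [Complex.natCast_re] at hu
  refine (isBigO_u0Order (isBigO_u0_neg_natCast N k) (by linarith) ?_).neg_left.sub
    ((((hu.trans (isBigO_rpow_rpow (by linarith))).const_mul_left _).add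
      (isBigO_u0Order hu (by linarith) ?_)).const_mul_left _)
  · rw [Complex.neg_re, Complex.natCast_re, sub_eq_add_neg]
  · rw [Complex.natCast_re]
    linarith

theorem isBigO_macdonaldNumOrderDeriv_natCast {N : ℕ} (hN : 1 ≤ N) (k : ℂ) :
    macdonaldNumOrderDeriv N k =O[𝓝[>] 0] fun x : ℝ => x ^ (-1 / 2 - (N : ℝ)) := by
  have hN' : (1 : ℝ) ≤ N := Nat.one_le_cast.2 hN
  have hu := isBigO_u0 N k
  have hDu := isBigO_u0Deriv N k
  rw [Complex.natCast_re] at hu hDu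
  refine (isBigO_u0OrderDeriv (isBigO_u0_neg_natCast N k) (by linarith) ?_).neg_left.sub
    ((((hDu.trans (isBigO_rpow_rpow (by linarith))).const_mul_left _).add
      (isBigO_u0OrderDeriv hu (by linarith) ?_)).const_mul_left _)
  · rw [Complex.neg_re, Complex.natCast_re, sub_eq_add_neg]
  · rw [Complex.natCast_re]
    linarith

end Macdonald

section UnperturbedFundamentalSystem

theorem solvesWith_u0 (m k : ℂ) : SolvesWith (freePotential m k) 0 (u0 m k) (u0Deriv m k) :=
  .of_hasDerivAt (continuousOn_freePotential m k) (fun _ => hasDerivAt_u0 m k)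
    fun _ => hasDerivAt_u0Deriv m k

theorem solvesWith_cpow_half_sub (m : ℂ) :
    SolvesWith (freePotential m 0) 0 (fun x : ℝ => (x : ℂ) ^ (1 / 2 - m))
      (fun x : ℝ => (1 / 2 - m) / x * (x : ℂ) ^ (1 / 2 - m)) := by
  refine .of_hasDerivAt (continuousOn_freePotential m 0)
    (fun x => hasDerivAt_ofReal_cpow (1 / 2 - m)) fun x hx => ?_
  refine ((hasDerivAt_const_div_ofReal (1 / 2 - m) hx).mul
    (hasDerivAt_ofReal_cpow (1 / 2 - m) hx)).congr_deriv ?_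
  simp only [freePotential]
  ring

theorem solvesWith_macdonaldNum (m k : ℂ) :
    SolvesWith (freePotential m k) 0 (macdonaldNum m k) (macdonaldNumDeriv m k) :=
  .of_hasDerivAt (continuousOn_freePotential m k) (fun _ => hasDerivAt_macdonaldNum m k)
    fun _ => hasDerivAt_macdonaldNumDeriv m k

theorem solvesWith_macdonaldNumOrder_natCast (N : ℕ) (k : ℂ) :
    SolvesWith (freePotential N k) 0 (macdonaldNumOrder N k) (macdonaldNumOrderDeriv N k) :=
  .of_hasDerivAt (continuousOn_freePotential N k) (fun _ => hasDerivAt_macdonaldNumOrder N k)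
    fun x hx => by
      simpa only [macdonaldNum_natCast N k hx, mul_zero, add_zero] using
        hasDerivAt_macdonaldNumOrderDeriv N k hx

theorem FundamentalSystem.of_const_mul_v0 {m k c : ℂ} {f D : ℝ → ℂ} (hm : 0 ≤ m.re)
    (hf : SolvesWith (freePotential m k) 0 f D)
    (hv : ∀ x : ℝ, 0 < x → c * f x = v0 m k x)
    (hw : ∀ x : ℝ, 0 < x → c * (f x * u0Deriv m k x - D x * u0 m k x) = 1)
    (hfO : f =O[𝓝[>] 0] fun x : ℝ => x ^ (1 / 2 - m.re))
    (hDO : D =O[𝓝[>] 0] fun x : ℝ => x ^ (-1 / 2 - m.re)) :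
    FundamentalSystem m.re (freePotential m k) (u0 m k) (v0 m k) (u0Deriv m k)
      (fun x => c * D x) where
  nonneg := hm
  solvesWith_u := solvesWith_u0 m k
  solvesWith_v := (hf.const_mul c).congr (fun _ _ => mul_zero c) hv
  wronskian x hx := by
    rw [← hv x hx]
    linear_combination hw x hx
  isBigO_u := isBigO_u0 m k
  isBigO_deriv_u := isBigO_u0Deriv m k
  isBigO_v := (hfO.const_mul_left c).congr' (by
    filter_upwards [self_mem_nhdsWithin] with x hx using hv x hx) .rfl
  isBigO_deriv_v := hDO.const_mul_left c

theorem exists_fundamentalSystem_zero {m : ℂ} (hm : 0 ≤ m.re) (hm0 : m ≠ 0) :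
    ∃ v', FundamentalSystem m.re (freePotential m 0) (u0 m 0) (v0 m 0) (u0Deriv m 0) v' := by
  refine ⟨_, .of_const_mul_v0 (c := Complex.Gamma m / 2) hm (solvesWith_cpow_half_sub m)
    (fun x _ => ?_) (fun x hx => ?_) (by simpa using isBigO_ofReal_cpow (1 / 2 - m))
    (isBigO_mul_rpow (isBigO_const_div_ofReal _) (isBigO_ofReal_cpow (1 / 2 - m)) ?_)⟩
  · rw [v0, if_pos rfl]
    ring
  · have hx0 := ofReal_ne_zero_of_pos hx
    have hGamma : m * Complex.Gamma m ≠ 0 := by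
      rw [← Complex.Gamma_add_one m hm0]
      exact Complex.Gamma_ne_zero_of_re_pos (by rw [Complex.add_re, Complex.one_re]; linarith)
    have hu : u0 m 0 x = (x : ℂ) ^ (1 / 2 + m) * (m * Complex.Gamma m)⁻¹ := by
      simp [u0, hypF_zero, Complex.Gamma_add_one m hm0]
    have hDu : u0Deriv m 0 x = (1 / 2 + m) / x * u0 m 0 x := by simp [u0Deriv]
    have hcpow : (x : ℂ) ^ (1 / 2 - m) * (x : ℂ) ^ (1 / 2 + m) / x = 1 := by
      rw [sub_eq_add_neg, cpow_half_add_neg_mul_cpow_half_add hx, div_self hx0]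
    rw [hDu, hu]
    linear_combination (m * Complex.Gamma m * (m * Complex.Gamma m)⁻¹) * hcpow +
      mul_inv_cancel₀ hGamma
  · simp
    linarith

theorem exists_fundamentalSystem_of_forall_ne_intCast {m k : ℂ} (hm : 0 ≤ m.re) (hk : k ≠ 0)
    (hmint : ¬∃ N : ℤ, m = N) :
    ∃ v', FundamentalSystem m.re (freePotential m k) (u0 m k) (v0 m k) (u0Deriv m k) v' := by
  have hpi : (Real.pi : ℂ) ≠ 0 := Complex.ofReal_ne_zero.2 Real.pi_ne_zero
  have hsin : Complex.sin (Real.pi * m) ≠ 0 := Complex.sin_ne_zero_iff.2 fun N hN =>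
    hmint ⟨N, mul_left_cancel₀ hpi (hN.trans (mul_comm _ _))⟩
  refine ⟨_, .of_const_mul_v0 (c := Real.pi / (2 * Complex.sin (Real.pi * m))) hm
    (solvesWith_macdonaldNum m k) (fun x _ => ?_) (fun x hx => ?_)
    (((isBigO_u0 (-m) k).trans (isBigO_rpow_rpow ?_)).sub
      (((isBigO_u0 m k).trans (isBigO_rpow_rpow ?_)).const_mul_left _))
    (((isBigO_u0Deriv (-m) k).trans (isBigO_rpow_rpow ?_)).sub
      (((isBigO_u0Deriv m k).trans (isBigO_rpow_rpow ?_)).const_mul_left _))⟩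
  · rw [v0, if_neg hk, if_neg hmint, v0NonInt, macdonaldNum]
  · rw [macdonaldNum_wronskian m k hx]
    field_simp
  all_goals
    try rw [Complex.neg_re]
    linarith

theorem exists_fundamentalSystem_natCast {N : ℕ} {k : ℂ} (hN : 1 ≤ N) (hk : k ≠ 0) :
    ∃ v', FundamentalSystem (N : ℂ).re (freePotential N k) (u0 N k) (v0 N k) (u0Deriv N k) v' := by
  refine ⟨_, .of_const_mul_v0 (by simp) (solvesWith_macdonaldNumOrder_natCast N k)
    (fun x hx => (v0_natCast N hk hx).symm) (fun x hx => ?_)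
    (by simpa using isBigO_macdonaldNumOrder_natCast hN k)
    (by simpa using isBigO_macdonaldNumOrderDeriv_natCast hN k)⟩
  rw [macdonaldNumOrder_wronskian_natCast N hk hx]
  exact inv_mul_cancel₀ (mul_ne_zero two_ne_zero (cos_pi_mul_natCast_ne_zero N))

theorem exists_fundamentalSystem {m : ℂ} (hm : 0 ≤ m.re) (hm0 : m ≠ 0) (k : ℂ) :
    ∃ v', FundamentalSystem m.re (freePotential m k) (u0 m k) (v0 m k) (u0Deriv m k) v' := by
  by_cases hk : k = 0
  · exact hk ▸ exists_fundamentalSystem_zero hm hm0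
  by_cases hmint : ∃ N : ℤ, m = N
  · obtain ⟨N, rfl⟩ := hmint
    lift N to ℕ using by simpa using hm
    rw [Int.cast_natCast] at hm0 ⊢
    exact exists_fundamentalSystem_natCast
      (Nat.one_le_iff_ne_zero.2 fun hN => hm0 (by rw [hN, Nat.cast_zero])) hk
  · exact exists_fundamentalSystem_of_forall_ne_intCast hm hk hmint

end UnperturbedFundamentalSystem

section Eigensolutions

variable {m k : ℂ} {Q f g h D : ℝ → ℂ}

theorem IsEigensolution.solvesWith (hf : IsEigensolution m k Q f)
    (hQ : LocallyIntegrableOn Q (Ioi 0)) :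
    SolvesWith (freePotential m k) (fun x => -(Q x * f x)) f (deriv f) := by
  obtain ⟨⟨hdiff, hac⟩, heq⟩ := hf
  have hfc : ContinuousOn f (Ioi 0) := fun x hx => (hdiff x hx).continuousAt.continuousWithinAt
  refine ⟨.of_hasDerivAt (fun x hx => (hdiff x hx).hasDerivAt)
    (continuousOn_Ioi_of_continuousOn_uIcc fun a b ha hab => (hac a b ha hab).continuousOn),
    .of_ae_hasDerivAt ?_ hac ?_⟩
  · exact (((continuousOn_freePotential m k).mul hfc).locallyIntegrableOn measurableSet_Ioi).sub
      (hQ.mul_continuousOn hfc isOpen_Ioi.isLocallyClosed).neg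
  · have hdiff' : ∀ᵐ x : ℝ, 0 < x → DifferentiableAt ℝ (deriv f) x :=
      ae_pos_of_forall_Icc fun a b ha hab => by
        simpa only [uIcc_of_le hab] using
          (hac a b ha hab).boundedVariationOn.ae_differentiableAt_of_mem_uIcc
    filter_upwards [hdiff', heq] with x hx hfx hx0
    refine (hx hx0).hasDerivAt.congr_deriv ?_
    simp only [freePotential]
    linear_combination -(hfx hx0)

theorem SolvesWith.isEigensolution
    (h : SolvesWith (freePotential m k) (fun x => -(Q x * f x)) f D) :
    IsEigensolution m k Q f := by
  have hD : EqOn D (deriv f) (Ioi 0) := fun x hx => (h.hasDerivAt hx).deriv.symm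
  refine ⟨⟨fun x hx => (h.hasDerivAt hx).differentiableAt, fun a b ha hab => ?_⟩, ?_⟩
  · have hb := ha.trans_le hab
    exact absolutelyContinuousOnInterval_congr
      (h.isLocalPrimitive_deriv.absolutelyContinuousOnInterval ha hb)
      (hD.mono (uIcc_subset_Ioi ha hb))
  · filter_upwards [h.isLocalPrimitive_deriv.ae_hasDerivAt] with x hx hx0
    have hderiv := (hx hx0).congr_of_eventuallyEq
      (eventuallyEq_of_mem (Ioi_mem_nhds hx0) hD.symm)
    rw [hderiv.deriv]
    simp only [freePotential]
    ring

theorem AgreesNearZero.congr_right (hfg : AgreesNearZero m f g) (hgh : EqOn g h (Ioo 0 1)) :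
    AgreesNearZero m f h := by
  have hmem := Ioo_mem_nhdsGT (zero_lt_one (α := ℝ))
  refine ⟨hfg.1.congr' ?_ .rfl, hfg.2.congr' ?_ .rfl⟩ <;> filter_upwards [hmem] with x hx
  · rw [hgh hx]
  · rw [(eventuallyEq_of_mem (Ioo_mem_nhds hx.1 hx.2) hgh).deriv_eq]

theorem eqOn_of_agreesNearZero (hm : 0 ≤ m.re) (hm0 : m ≠ 0) (hQ : Q ∈ PotentialClass 0)
    (hf : IsEigensolution m k Q f) (hg : IsEigensolution m k Q g) (hfh : AgreesNearZero m f h)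
    (hgh : AgreesNearZero m g h) : EqOn f g (Ioi 0) := by
  obtain ⟨v', S⟩ := exists_fundamentalSystem hm hm0 k
  have hsub : SolvesWith (freePotential m k) (fun x => -(Q x * (f x + -1 * g x)))
      (fun x => f x + -1 * g x) (fun x => deriv f x + -1 * deriv g x) :=
    ((hf.solvesWith hQ.1).add ((hg.solvesWith hQ.1).const_mul (-1))).congr
      (fun x _ => by ring) (eqOn_refl _ _)
  intro x hx
  have hzero := S.eq_zero_of_isLittleO hQ hsub ((hfh.1.sub hgh.1).congr_left fun x => by ring)
    ((hfh.2.sub hgh.2).congr_left fun x => by ring) hx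
  linear_combination hzero

end Eigensolutions

section Kernels

variable {m k : ℂ} {Q f g : ℝ → ℂ} {G : ℝ → ℝ → ℂ} {x : ℝ}

theorem GreenQDefinedAt.congr (hf : GreenQDefinedAt G Q f x)
    (hfg : EqOn (fun y => G x y * (Q y * f y)) (fun y => G x y * (Q y * g y)) (Ioi 0)) :
    GreenQDefinedAt G Q g x :=
  IntegrableOn.congr_fun hf hfg measurableSet_Ioi

theorem greenQ_congr
    (hfg : EqOn (fun y => G x y * (Q y * f y)) (fun y => G x y * (Q y * g y)) (Ioi 0)) :
    greenQ G Q f x = greenQ G Q g x :=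
  setIntegral_congr_fun measurableSet_Ioi hfg

theorem twoSidedKernelOn_mul_congr (hfg : EqOn f g (Ioc 0 1)) (x : ℝ) :
    EqOn (fun y => twoSidedKernelOn 1 m k x y * (Q y * f y))
      (fun y => twoSidedKernelOn 1 m k x y * (Q y * g y)) (Ioi 0) := by
  intro y hy
  by_cases hy1 : y ≤ 1
  · simp only [hfg ⟨hy, hy1⟩]
  · simp only [twoSidedKernelOn, hy1, and_false, if_false, zero_mul]

theorem forwardKernel_mul_congr (hfg : EqOn f g (Ioc 0 x)) :
    EqOn (fun y => forwardKernel m k x y * (Q y * f y))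
      (fun y => forwardKernel m k x y * (Q y * g y)) (Ioi 0) := by
  intro y hy
  by_cases hyx : y ≤ x
  · simp only [hfg ⟨hy, hyx⟩]
  · simp only [forwardKernel, hyx, if_false, zero_mul]

theorem twoSidedKernelOn_mul_eqOn_indicator (p : ℝ → ℂ) (hx : x ≤ 1) :
    EqOn (fun y => (Ioc 0 x).indicator (fun y => v0 m k x * (u0 m k y * p y)) y +
        (Ioc x 1).indicator (fun y => u0 m k x * (v0 m k y * p y)) y)
      (fun y => twoSidedKernelOn 1 m k x y * p y) (Ioi 0) := by
  intro y hy
  have hy0 : 0 < y := hy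
  rcases le_or_gt y x with hyx | hxy
  · simp [twoSidedKernelOn, twoSidedKernel, hx, hy0, hyx, hyx.trans hx, not_lt.2 hyx, mul_assoc]
  · simp [twoSidedKernelOn, twoSidedKernel, indicator, hx, hxy, not_le.2 hxy, mul_assoc]

theorem forwardKernel_mul_eqOn_indicator (p : ℝ → ℂ) (x : ℝ) :
    EqOn ((Ioc 0 x).indicator
        fun y => v0 m k x * (u0 m k y * p y) - u0 m k x * (v0 m k y * p y))
      (fun y => forwardKernel m k x y * p y) (Ioi 0) := by
  intro y hy
  have hy0 : 0 < y := hy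
  rcases le_or_gt y x with hyx | hxy
  · simp [forwardKernel, hy0, hyx, sub_mul, mul_assoc]
  · simp [forwardKernel, not_le.2 hxy]

theorem greenQDefinedAt_twoSidedKernelOn_of_one_lt (hx : 1 < x) :
    GreenQDefinedAt (twoSidedKernelOn 1 m k) Q f x := by
  simp [GreenQDefinedAt, twoSidedKernelOn, not_le.2 hx]

theorem greenQDefinedAt_twoSidedKernelOn (hx : x ≤ 1)
    (hu : IntegrableOn (fun y => u0 m k y * (Q y * f y)) (Ioc 0 x))
    (hv : IntegrableOn (fun y => v0 m k y * (Q y * f y)) (Ioc x 1)) :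
    GreenQDefinedAt (twoSidedKernelOn 1 m k) Q f x :=
  IntegrableOn.congr_fun
    ((IntegrableOn.integrable_indicator (hu.const_mul _) measurableSet_Ioc).integrableOn.add
      (IntegrableOn.integrable_indicator (hv.const_mul _) measurableSet_Ioc).integrableOn)
    (twoSidedKernelOn_mul_eqOn_indicator _ hx) measurableSet_Ioi

theorem greenQ_twoSidedKernelOn (hx : x ∈ Ioc 0 1)
    (hu : IntegrableOn (fun y => u0 m k y * (Q y * f y)) (Ioc 0 x))
    (hv : IntegrableOn (fun y => v0 m k y * (Q y * f y)) (Ioc x 1)) :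
    greenQ (twoSidedKernelOn 1 m k) Q f x =
      twoSidedOp (u0 m k) (v0 m k) (fun y => Q y * f y) x := by
  rw [greenQ, ← setIntegral_congr_fun measurableSet_Ioi
    (twoSidedKernelOn_mul_eqOn_indicator _ hx.2), integral_add
    (IntegrableOn.integrable_indicator (hu.const_mul _) measurableSet_Ioc).integrableOn
    (IntegrableOn.integrable_indicator (hv.const_mul _) measurableSet_Ioc).integrableOn,
    setIntegral_indicator measurableSet_Ioc, setIntegral_indicator measurableSet_Ioc,
    inter_eq_right.2 Ioc_subset_Ioi_self,
    inter_eq_right.2 (Ioc_subset_Ioi_self.trans (Ioi_subset_Ioi hx.1.le)),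
    integral_const_mul, integral_const_mul, twoSidedOp,
    intervalIntegral.integral_of_le hx.1.le, intervalIntegral.integral_of_le hx.2]

theorem greenQDefinedAt_forwardKernel
    (hu : IntegrableOn (fun y => u0 m k y * (Q y * f y)) (Ioc 0 x))
    (hv : IntegrableOn (fun y => v0 m k y * (Q y * f y)) (Ioc 0 x)) :
    GreenQDefinedAt (forwardKernel m k) Q f x :=
  IntegrableOn.congr_fun
    (IntegrableOn.integrable_indicator ((hu.const_mul _).sub (hv.const_mul _))
      measurableSet_Ioc).integrableOn
    (forwardKernel_mul_eqOn_indicator _ x) measurableSet_Ioi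

theorem greenQ_forwardKernel (hx : 0 < x)
    (hu : IntegrableOn (fun y => u0 m k y * (Q y * f y)) (Ioc 0 x))
    (hv : IntegrableOn (fun y => v0 m k y * (Q y * f y)) (Ioc 0 x)) :
    greenQ (forwardKernel m k) Q f x = forwardOp (u0 m k) (v0 m k) (fun y => Q y * f y) x := by
  rw [greenQ, ← setIntegral_congr_fun measurableSet_Ioi (forwardKernel_mul_eqOn_indicator _ x),
    setIntegral_indicator measurableSet_Ioc, inter_eq_right.2 Ioc_subset_Ioi_self,
    integral_sub (hu.const_mul _) (hv.const_mul _), integral_const_mul, integral_const_mul,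
    forwardOp, intervalIntegral.integral_of_le hx.le, intervalIntegral.integral_of_le hx.le]

end Kernels

section Iterates

/-- The iterates `(G Q)^j u⁰_{-m}` of the two-sided Green operator on `]0,1[`, continued to
`]0,∞[` by `twoSidedOp`, so that each solves the unperturbed equation with `Q` times its
predecessor as inhomogeneity. -/
noncomputable def extIter (m k : ℂ) (Q : ℝ → ℂ) (j : ℕ) : ℝ → ℂ :=
  (fun f => twoSidedOp (u0 m k) (v0 m k) fun y => Q y * f y)^[j] (u0 (-m) k)

/-- The truncated series built from the continued iterates; it equals `trunc` on `]0,1]` and,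
unlike `trunc`, solves a differential equation on all of `]0,∞[`. -/
noncomputable def extTrunc (m k : ℂ) (Q : ℝ → ℂ) (n : ℕ) (x : ℝ) : ℂ :=
  ∑ j ∈ Finset.range (n + 1), (-1) ^ j * extIter m k Q j x

theorem extIter_succ (m k : ℂ) (Q : ℝ → ℂ) (j : ℕ) :
    extIter m k Q (j + 1) =
      twoSidedOp (u0 m k) (v0 m k) fun y => Q y * extIter m k Q j y :=
  Function.iterate_succ_apply' _ _ _

theorem iter_succ (m k : ℂ) (Q : ℝ → ℂ) (j : ℕ) :
    iter m k Q (j + 1) = greenQ (twoSidedKernelOn 1 m k) Q (iter m k Q j) :=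
  Function.iterate_succ_apply' _ _ _

theorem greenQ_const_mul (G : ℝ → ℝ → ℂ) (Q f : ℝ → ℂ) (c : ℂ) :
    greenQ G Q (fun x => c * f x) = fun x => c * greenQ G Q f x := by
  funext x
  simp only [greenQ, mul_left_comm _ c, integral_const_mul]

theorem trunc_eq_sum_iter (m k : ℂ) (Q : ℝ → ℂ) (n : ℕ) (x : ℝ) :
    trunc m k Q n x = ∑ j ∈ Finset.range (n + 1), (-1) ^ j * iter m k Q j x := by
  have hiter : ∀ j, (fun f : ℝ → ℂ => -greenQ (twoSidedKernelOn 1 m k) Q f)^[j] (u0 (-m) k) =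
      fun x => (-1) ^ j * iter m k Q j x := by
    intro j
    induction j with
    | zero => simp [iter]
    | succ j ih =>
      rw [Function.iterate_succ_apply', ih, iter_succ, greenQ_const_mul]
      funext x
      simp only [Pi.neg_apply, pow_succ, mul_neg_one, neg_mul]
  simp only [trunc, hiter]

variable {m k : ℂ} {Q : ℝ → ℂ} {ε : ℝ}

theorem continuousOn_extIter_and_isBigO (hm : 0 ≤ m.re) (hm0 : m ≠ 0) (hε : 0 ≤ ε)
    (hQ : Q ∈ PotentialClass ε) (j : ℕ) :
    ContinuousOn (extIter m k Q j) (Ioi 0) ∧ extIter m k Q j =O[𝓝[>] 0]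
      fun x : ℝ => x ^ (1 / 2 - m.re + min (j * ε) (2 * m.re)) := by
  obtain ⟨v', S⟩ := exists_fundamentalSystem hm hm0 k
  induction j with
  | zero =>
    refine ⟨(solvesWith_u0 (-m) k).continuousOn, ?_⟩
    have hmin : min (((0 : ℕ) : ℝ) * ε) (2 * m.re) = 0 := by simpa using hm
    rw [hmin, add_zero, sub_eq_add_neg, ← Complex.neg_re]
    exact isBigO_u0 (-m) k
  | succ j ih =>
    have hmem : (fun x => Q x * extIter m k Q j x) ∈
        PotentialClass (1 / 2 - m.re + min ((j + 1 : ℕ) * ε) (2 * m.re)) := by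
      refine mul_mem_potentialClass_of_isBigO_right hQ ih.1 ih.2 ?_
      have hmin : min ((j + 1 : ℕ) * ε) (2 * m.re) ≤ min (j * ε) (2 * m.re) + ε := by
        push_cast
        rw [← min_add_add_right, add_one_mul]
        exact min_le_min le_rfl (by linarith)
      linarith
    have hmin0 : 0 ≤ min ((j + 1 : ℕ) * ε) (2 * m.re) := le_min (by positivity) (by linarith)
    rw [extIter_succ]
    refine ⟨?_, S.isBigO_twoSidedOp hmem hmin0 (min_le_right _ _)⟩
    obtain ⟨D, hD⟩ :=
      S.exists_solvesWith_twoSidedOp (antitone_potentialClass (by linarith) hmem)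
    exact hD.continuousOn

theorem isBigO_extIter (hm : 0 ≤ m.re) (hm0 : m ≠ 0) (hε : 0 ≤ ε) (hQ : Q ∈ PotentialClass ε)
    (j : ℕ) : extIter m k Q j =O[𝓝[>] 0] fun x : ℝ => x ^ (1 / 2 - m.re) :=
  (continuousOn_extIter_and_isBigO hm hm0 hε hQ j).2.trans <| isBigO_rpow_rpow <|
    le_add_of_nonneg_right (le_min (by positivity) (by linarith))

theorem mul_extIter_mem_potentialClass_sub (hm : 0 ≤ m.re) (hm0 : m ≠ 0) (hε : 0 ≤ ε)
    (hQ : Q ∈ PotentialClass ε) (j : ℕ) :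
    (fun x => Q x * extIter m k Q j x) ∈ PotentialClass (1 / 2 - m.re) :=
  mul_mem_potentialClass_of_isBigO_right hQ (continuousOn_extIter_and_isBigO hm hm0 hε hQ j).1
    (isBigO_extIter hm hm0 hε hQ j) (by linarith)

theorem mul_extIter_mem_potentialClass_add (hm : 0 ≤ m.re) (hm0 : m ≠ 0) (hε : 0 ≤ ε)
    (hQ : Q ∈ PotentialClass ε) {n : ℕ} (hn : m.re ≤ ε / 2 * (n + 1)) :
    (fun x => Q x * extIter m k Q n x) ∈ PotentialClass (1 / 2 + m.re) := by
  obtain ⟨hcont, hO⟩ := continuousOn_extIter_and_isBigO (k := k) hm hm0 hε hQ n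
  refine mul_mem_potentialClass_of_isBigO_right hQ hcont hO ?_
  have hmin : 2 * m.re - ε ≤ min (n * ε) (2 * m.re) := le_min (by linarith) (by linarith)
  linarith

theorem greenQ_extIter (hm : 0 ≤ m.re) (hm0 : m ≠ 0) (hε : 0 ≤ ε) (hQ : Q ∈ PotentialClass ε)
    (j : ℕ) {x : ℝ} (hx : x ∈ Ioc 0 1) :
    GreenQDefinedAt (twoSidedKernelOn 1 m k) Q (extIter m k Q j) x ∧
      greenQ (twoSidedKernelOn 1 m k) Q (extIter m k Q j) x = extIter m k Q (j + 1) x := by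
  obtain ⟨v', S⟩ := exists_fundamentalSystem hm hm0 k
  have hmem := mul_extIter_mem_potentialClass_sub (k := k) hm hm0 hε hQ j
  have hu := S.integrableOn_u_mul hmem x
  have hv := (intervalIntegrable_iff_integrableOn_Ioc_of_le hx.2).1 <|
    intervalIntegrable_of_locallyIntegrableOn
      (hmem.1.continuousOn_mul S.continuousOn_v isOpen_Ioi.isLocallyClosed) hx.1 one_pos
  exact ⟨greenQDefinedAt_twoSidedKernelOn hx.2 hu hv,
    (greenQ_twoSidedKernelOn hx hu hv).trans (congrFun (extIter_succ m k Q j) x).symm⟩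

theorem extIter_eqOn_iter (hm : 0 ≤ m.re) (hm0 : m ≠ 0) (hε : 0 ≤ ε) (hQ : Q ∈ PotentialClass ε)
    (j : ℕ) : EqOn (extIter m k Q j) (iter m k Q j) (Ioc 0 1) := by
  induction j with
  | zero => exact eqOn_refl _ _
  | succ j ih =>
    intro x hx
    rw [← (greenQ_extIter hm hm0 hε hQ j hx).2, iter_succ]
    exact greenQ_congr (twoSidedKernelOn_mul_congr ih x)

theorem greenQDefinedAt_iter (hm : 0 ≤ m.re) (hm0 : m ≠ 0) (hε : 0 ≤ ε)
    (hQ : Q ∈ PotentialClass ε) (j : ℕ) {x : ℝ} (hx : 0 < x) :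
    GreenQDefinedAt (twoSidedKernelOn 1 m k) Q (iter m k Q j) x := by
  rcases le_or_gt x 1 with hx1 | hx1
  · exact (greenQ_extIter hm hm0 hε hQ j ⟨hx, hx1⟩).1.congr
      (twoSidedKernelOn_mul_congr (extIter_eqOn_iter hm hm0 hε hQ j) x)
  · exact greenQDefinedAt_twoSidedKernelOn_of_one_lt hx1

theorem greenQDefinedAt_forwardKernel_iter (hm : 0 ≤ m.re) (hm0 : m ≠ 0) (hε : 0 ≤ ε)
    (hQ : Q ∈ PotentialClass ε) {n : ℕ} (hn : m.re ≤ ε / 2 * (n + 1)) {x : ℝ} (hx : x ≤ 1) :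
    GreenQDefinedAt (forwardKernel m k) Q (iter m k Q n) x := by
  obtain ⟨v', S⟩ := exists_fundamentalSystem hm hm0 k
  have hmem := mul_extIter_mem_potentialClass_add (k := k) hm hm0 hε hQ hn
  exact (greenQDefinedAt_forwardKernel (S.integrableOn_u_mul (S.mem_potentialClass_sub hmem) x)
    (S.integrableOn_v_mul hmem x)).congr <| forwardKernel_mul_congr <|
      (extIter_eqOn_iter hm hm0 hε hQ n).mono (Ioc_subset_Ioc_right hx)

theorem greenQ_forwardKernel_iter (hm : 0 ≤ m.re) (hm0 : m ≠ 0) (hε : 0 ≤ ε)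
    (hQ : Q ∈ PotentialClass ε) {n : ℕ} (hn : m.re ≤ ε / 2 * (n + 1)) {x : ℝ}
    (hx : x ∈ Ioc 0 1) :
    greenQ (forwardKernel m k) Q (iter m k Q n) x =
      forwardOp (u0 m k) (v0 m k) (fun y => Q y * extIter m k Q n y) x := by
  obtain ⟨v', S⟩ := exists_fundamentalSystem hm hm0 k
  have hmem := mul_extIter_mem_potentialClass_add (k := k) hm hm0 hε hQ hn
  rw [← greenQ_forwardKernel hx.1 (S.integrableOn_u_mul (S.mem_potentialClass_sub hmem) x)
    (S.integrableOn_v_mul hmem x)]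
  exact (greenQ_congr <| forwardKernel_mul_congr <|
    (extIter_eqOn_iter hm hm0 hε hQ n).mono (Ioc_subset_Ioc_right hx.2)).symm

theorem extTrunc_eqOn_trunc (hm : 0 ≤ m.re) (hm0 : m ≠ 0) (hε : 0 ≤ ε)
    (hQ : Q ∈ PotentialClass ε) (n : ℕ) : EqOn (extTrunc m k Q n) (trunc m k Q n) (Ioc 0 1) := by
  intro x hx
  rw [trunc_eq_sum_iter, extTrunc]
  exact Finset.sum_congr rfl fun j _ => by rw [extIter_eqOn_iter hm hm0 hε hQ j hx]

theorem isBigO_extTrunc (hm : 0 ≤ m.re) (hm0 : m ≠ 0) (hε : 0 ≤ ε) (hQ : Q ∈ PotentialClass ε)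
    (n : ℕ) : extTrunc m k Q n =O[𝓝[>] 0] fun x : ℝ => x ^ (1 / 2 - m.re) :=
  IsBigO.fun_sum fun j _ => (isBigO_extIter hm hm0 hε hQ j).const_mul_left _

theorem exists_solvesWith_extTrunc (hm : 0 ≤ m.re) (hm0 : m ≠ 0) (hε : 0 ≤ ε)
    (hQ : Q ∈ PotentialClass ε) (n : ℕ) :
    ∃ D : ℝ → ℂ, SolvesWith (freePotential m k)
      (fun x => -(Q x * extTrunc m k Q n x) + (-1) ^ n * (Q x * extIter m k Q n x))
      (extTrunc m k Q n) D := by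
  obtain ⟨v', S⟩ := exists_fundamentalSystem hm hm0 k
  induction n with
  | zero =>
    have hu0 := solvesWith_u0 (-m) k
    rw [freePotential_neg] at hu0
    exact ⟨_, hu0.congr (fun x _ => by simp [extTrunc, extIter])
      (fun x _ => by simp [extTrunc, extIter])⟩
  | succ n ih =>
    obtain ⟨D, hD⟩ := ih
    obtain ⟨E, hE⟩ := S.exists_solvesWith_twoSidedOp
      (mul_extIter_mem_potentialClass_sub (k := k) hm hm0 hε hQ n)
    have hsucc : ∀ x, extTrunc m k Q (n + 1) x =
        extTrunc m k Q n x + (-1) ^ (n + 1) * extIter m k Q (n + 1) x := fun x =>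
      Finset.sum_range_succ _ _
    refine ⟨_, (hD.add (hE.const_mul ((-1) ^ (n + 1)))).congr (fun x _ => ?_) (fun x _ => ?_)⟩
    · simp only [hsucc]
      ring
    · simp only [hsucc, extIter_succ]

theorem differentiableAt_trunc (hm : 0 ≤ m.re) (hm0 : m ≠ 0) (hε : 0 ≤ ε)
    (hQ : Q ∈ PotentialClass ε) (n : ℕ) {x : ℝ} (hx : x ∈ Ioo 0 1) :
    DifferentiableAt ℝ (trunc m k Q n) x := by
  obtain ⟨D, hD⟩ := exists_solvesWith_extTrunc (k := k) hm hm0 hε hQ n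
  exact (hD.hasDerivAt hx.1).differentiableAt.congr_of_eventuallyEq <|
    (eventuallyEq_of_mem (Ioc_mem_nhds hx.1 hx.2) (extTrunc_eqOn_trunc hm hm0 hε hQ n)).symm

/-- The defect of the truncated series with parameter `k'` as a solution of the perturbed
equation with parameter `k`. -/
noncomputable def truncDefect (m k k' : ℂ) (Q : ℝ → ℂ) (n : ℕ) (x : ℝ) : ℂ :=
  (-1) ^ (n + 1) * (Q x * extIter m k' Q n x) + (k' ^ 2 - k ^ 2) * extTrunc m k' Q n x

theorem exists_solvesWith_sub_truncDefect (hm : 0 ≤ m.re) (hm0 : m ≠ 0) (hε : 0 ≤ ε)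
    (hQ : Q ∈ PotentialClass ε) (n : ℕ) (k k' : ℂ) :
    ∃ D : ℝ → ℂ, SolvesWith (freePotential m k)
      (fun x => -(Q x * extTrunc m k' Q n x) - truncDefect m k k' Q n x)
      (extTrunc m k' Q n) D := by
  obtain ⟨D, hD⟩ := exists_solvesWith_extTrunc (k := k') hm hm0 hε hQ n
  refine ⟨D, hD.isLocalPrimitive, hD.isLocalPrimitive_deriv.congr (fun x _ => ?_) (eqOn_refl _ _)⟩
  simp only [freePotential, truncDefect]
  ring

theorem truncDefect_mem_potentialClass (hm : 0 ≤ m.re) (hm0 : m ≠ 0) (hε : 0 ≤ ε)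
    (hQ : Q ∈ PotentialClass ε) {n : ℕ} (hn : m.re ≤ ε / 2 * (n + 1)) {k' : ℂ}
    (hk' : k' = k ∨ m.re < 1) : truncDefect m k k' Q n ∈ PotentialClass (1 / 2 + m.re) := by
  have hiter := const_mul_mem_potentialClass ((-1) ^ (n + 1))
    (mul_extIter_mem_potentialClass_add (k := k') hm hm0 hε hQ hn)
  rcases hk' with rfl | hlt
  · unfold truncDefect
    simpa only [sub_self, zero_mul, add_zero] using hiter
  · obtain ⟨D, hD⟩ := exists_solvesWith_extTrunc (k := k') hm hm0 hε hQ n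
    have htrunc : extTrunc m k' Q n ∈ PotentialClass (1 / 2 + m.re) := by
      simpa only [one_mul] using mul_mem_potentialClass_of_isBigO_right
        (one_mem_potentialClass (ε := 2 * m.re) (by linarith)) hD.continuousOn
        (isBigO_extTrunc hm hm0 hε hQ n) (by linarith)
    exact add_mem_potentialClass hiter (const_mul_mem_potentialClass _ htrunc)

end Iterates

section ForwardResolvent

variable {m k : ℂ} {Q F r s : ℝ → ℂ}

theorem IsForwardResolvent.mul_indicator_mem_potentialClass (hr : IsForwardResolvent m k Q F r)
    (hQ : Q ∈ PotentialClass 0) :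
    (fun y => Q y * (Ioo 0 1).indicator r y) ∈ PotentialClass (1 / 2 + m.re) := by
  obtain ⟨hmeas, ⟨C, hC⟩, -⟩ := hr
  refine mul_mem_potentialClass hQ
    (((aestronglyMeasurable_indicator_iff measurableSet_Ioo).2 hmeas).mono_measure
      Measure.restrict_le_self) (fun X => ⟨|C|, ?_⟩) (zero_add _).ge
  filter_upwards [ae_restrict_of_ae ((ae_restrict_iff' measurableSet_Ioo).1 hC),
    ae_restrict_mem measurableSet_Ioc] with y hyC hy
  have hpow : 0 ≤ y ^ (1 / 2 + m.re) := Real.rpow_nonneg hy.1.le _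
  by_cases hy1 : y ∈ Ioo 0 1
  · rw [indicator_of_mem hy1]
    exact (hyC hy1).trans (mul_le_mul_of_nonneg_right (le_abs_self C) hpow)
  · rw [indicator_of_notMem hy1, norm_zero]
    positivity

theorem IsForwardResolvent.add_forwardOp_indicator (hr : IsForwardResolvent m k Q F r)
    (hm : 0 ≤ m.re) (hm0 : m ≠ 0) (hQ : Q ∈ PotentialClass 0) {x : ℝ} (hx : x ∈ Ioo 0 1) :
    r x + forwardOp (u0 m k) (v0 m k) (fun y => Q y * (Ioo 0 1).indicator r y) x = F x := by
  obtain ⟨v', S⟩ := exists_fundamentalSystem hm hm0 k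
  have hmem := hr.mul_indicator_mem_potentialClass hQ
  rw [← hr.2.2 x hx, ← greenQ_forwardKernel hx.1
    (S.integrableOn_u_mul (S.mem_potentialClass_sub hmem) x) (S.integrableOn_v_mul hmem x)]
  exact congrArg (r x + ·) <| greenQ_congr <| forwardKernel_mul_congr fun y hy =>
    indicator_of_mem (Ioc_subset_Ioo_right hx.2 hy) r

theorem IsForwardResolvent.eqOn (hs : IsForwardResolvent m k Q F s)
    (hr : IsForwardResolvent m k Q F r) (hm : 0 ≤ m.re) (hm0 : m ≠ 0)
    (hQ : Q ∈ PotentialClass 0) : EqOn s r (Ioo 0 1) := by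
  obtain ⟨v', S⟩ := exists_fundamentalSystem hm hm0 k
  obtain ⟨Mr, hMr⟩ := hr.2.1
  obtain ⟨Ms, hMs⟩ := hs.2.1
  set d : ℝ → ℂ := fun x => (Ioo 0 1).indicator s x - (Ioo 0 1).indicator r x
  have hd : ∀ x ∈ Ioo (0 : ℝ) 1, d x = s x - r x := fun x hx => by
    simp only [d, indicator_of_mem hx]
  have hbound : ∀ᵐ y ∂volume.restrict (Ioo 0 1), ‖d y‖ ≤ (Ms + Mr) * y ^ (1 / 2 + m.re) := by
    filter_upwards [hMr, hMs, ae_restrict_mem measurableSet_Ioo] with y hyr hys hy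
    rw [hd y hy, add_mul]
    exact (norm_sub_le _ _).trans (add_le_add hys hyr)
  have hvolterra : ∀ x ∈ Ioo (0 : ℝ) 1,
      d x = -forwardOp (u0 m k) (v0 m k) (fun y => Q y * d y) x := by
    intro x hx
    simp only [hd x hx]
    simp only [d, mul_sub]
    rw [S.forwardOp_sub (hs.mul_indicator_mem_potentialClass hQ)
      (hr.mul_indicator_mem_potentialClass hQ) hx.1]
    linear_combination hs.add_forwardOp_indicator hm hm0 hQ hx -
      hr.add_forwardOp_indicator hm hm0 hQ hx
  intro x hx
  rw [← sub_eq_zero, ← hd x hx]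
  exact S.eq_zero_of_eq_neg_forwardOp hQ hbound hvolterra x hx

theorem isForwardResolvent_of_isBigO (hm : 0 ≤ m.re) (hm0 : m ≠ 0) (hQ : Q ∈ PotentialClass 0)
    (hr : ContinuousOn r (Ioi 0)) (hrO : r =O[𝓝[>] 0] fun x : ℝ => x ^ (1 / 2 + m.re))
    (hF : ∀ x ∈ Ioo (0 : ℝ) 1,
      r x + forwardOp (u0 m k) (v0 m k) (fun y => Q y * r y) x = F x) :
    IsForwardResolvent m k Q F r := by
  obtain ⟨v', S⟩ := exists_fundamentalSystem hm hm0 k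
  obtain ⟨M, -, hM⟩ := exists_norm_le_rpow_of_isBigO hr hrO 1
  have hmem := FundamentalSystem.mul_mem_potentialClass hQ hr hrO
  refine ⟨(hr.mono Ioo_subset_Ioi_self).aestronglyMeasurable measurableSet_Ioo,
    ⟨M, ae_restrict_of_forall_mem measurableSet_Ioo fun x hx => hM x ⟨hx.1, hx.2.le⟩⟩,
    fun x hx => ?_⟩
  rw [← hF x hx, greenQ_forwardKernel hx.1
    (S.integrableOn_u_mul (S.mem_potentialClass_sub hmem) x) (S.integrableOn_v_mul hmem x)]

end ForwardResolvent

section Solution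

variable {m k : ℂ} {Q : ℝ → ℂ} {ε : ℝ}

theorem exists_eigensolution_extTrunc_add (hm : 0 ≤ m.re) (hm0 : m ≠ 0) (hε : 0 ≤ ε)
    (hQ : Q ∈ PotentialClass ε) {n : ℕ} (hn : m.re ≤ ε / 2 * (n + 1)) {k' : ℂ}
    (hk' : k' = k ∨ m.re < 1) :
    ∃ r : ℝ → ℂ, IsEigensolution m k Q (fun x => extTrunc m k' Q n x + r x) ∧
      AgreesNearZero m (fun x => extTrunc m k' Q n x + r x) (trunc m k' Q n) ∧
      ContinuousOn r (Ioi 0) ∧ (r =O[𝓝[>] 0] fun x : ℝ => x ^ (1 / 2 + m.re)) ∧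
      ∀ x : ℝ, 0 < x → r x + forwardOp (u0 m k) (v0 m k) (fun y => Q y * r y) x =
        forwardOp (u0 m k) (v0 m k) (truncDefect m k k' Q n) x := by
  obtain ⟨v', S⟩ := exists_fundamentalSystem hm hm0 k
  obtain ⟨D, hD⟩ := exists_solvesWith_sub_truncDefect hm hm0 hε hQ n k k'
  obtain ⟨r, Dr, hsolves, hr, hDr, hcont, hvolterra⟩ := S.exists_correction
    (antitone_potentialClass hε hQ) (truncDefect_mem_potentialClass hm hm0 hε hQ hn hk') hD
  have hagrees : AgreesNearZero m (fun x => extTrunc m k' Q n x + r x) (extTrunc m k' Q n) := by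
    refine ⟨hr.congr_left fun x => (add_sub_cancel_left _ _).symm, hDr.congr' ?_ .rfl⟩
    filter_upwards [self_mem_nhdsWithin] with x hx
    rw [(hsolves.hasDerivAt hx).deriv, (hD.hasDerivAt hx).deriv, add_sub_cancel_left]
  exact ⟨r, hsolves.isEigensolution, hagrees.congr_right
    ((extTrunc_eqOn_trunc hm hm0 hε hQ n).mono Ioo_subset_Ioc_self), hcont, hr.isBigO, hvolterra⟩

theorem existsUnique_eigensolution_agreesNearZero (hm : 0 ≤ m.re) (hm0 : m ≠ 0) (hε : 0 ≤ ε)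
    (hQ : Q ∈ PotentialClass ε) {n : ℕ} (hn : m.re ≤ ε / 2 * (n + 1)) {k' : ℂ}
    (hk' : k' = k ∨ m.re < 1) :
    ∃ g : ℝ → ℂ, (IsEigensolution m k Q g ∧ AgreesNearZero m g (trunc m k' Q n)) ∧
      ∀ h : ℝ → ℂ, IsEigensolution m k Q h → AgreesNearZero m h (trunc m k' Q n) →
        EqOn h g (Ioi 0) := by
  obtain ⟨r, hg, hgT, -⟩ := exists_eigensolution_extTrunc_add hm hm0 hε hQ hn hk'
  exact ⟨_, ⟨hg, hgT⟩, fun h hh hhT =>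
    eqOn_of_agreesNearZero hm hm0 (antitone_potentialClass hε hQ) hh hg hhT hgT⟩

theorem forwardOp_const_mul (u v p : ℝ → ℂ) (c : ℂ) (x : ℝ) :
    forwardOp u v (fun y => c * p y) x = c * forwardOp u v p x := by
  simp only [forwardOp, mul_left_comm _ c, intervalIntegral.integral_const_mul]
  ring

theorem exists_forwardResolvent_eigensolution (hm : 0 ≤ m.re) (hm0 : m ≠ 0) (hε : 0 ≤ ε)
    (hQ : Q ∈ PotentialClass ε) {n : ℕ} (hn : m.re ≤ ε / 2 * (n + 1)) :
    ∃ r : ℝ → ℂ, IsForwardResolvent m k Q (greenQ (forwardKernel m k) Q (iter m k Q n)) r ∧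
      IsEigensolution m k Q (fun x => extTrunc m k Q n x + (-1) ^ (n + 1) * r x) ∧
      AgreesNearZero m (fun x => extTrunc m k Q n x + (-1) ^ (n + 1) * r x)
        (trunc m k Q n) := by
  obtain ⟨r, hg, hgT, hcont, hO, hvolterra⟩ :=
    exists_eigensolution_extTrunc_add (k := k) hm hm0 hε hQ hn (.inl rfl)
  have hsq : (-1 : ℂ) ^ (n + 1) * (-1) ^ (n + 1) = 1 := by
    rw [← mul_pow, neg_one_mul, neg_neg, one_pow]
  have hcancel : ∀ z : ℂ, (-1) ^ (n + 1) * ((-1) ^ (n + 1) * z) = z := fun z => by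
    rw [← mul_assoc, hsq, one_mul]
  refine ⟨fun x => (-1) ^ (n + 1) * r x, isForwardResolvent_of_isBigO hm hm0
    (antitone_potentialClass hε hQ) (continuousOn_const.mul hcont) (hO.const_mul_left _)
    fun x hx => ?_, by simpa only [hcancel] using hg, by simpa only [hcancel] using hgT⟩
  have hx' := hvolterra x hx.1
  unfold truncDefect at hx'
  simp only [sub_self, zero_mul, add_zero, forwardOp_const_mul] at hx'
  rw [greenQ_forwardKernel_iter hm hm0 hε hQ hn ⟨hx.1, hx.2.le⟩]
  simp only [mul_left_comm (Q _), forwardOp_const_mul, ← mul_add, hx', hcancel]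

end Solution

theorem mainTheorem7_general (m k : ℂ) (hm : 0 ≤ m.re) (hm0 : m ≠ 0) (ε : ℝ) (Q : ℝ → ℂ)
    (hQ : Q ∈ PotentialClass ε) (n : ℕ) (hn : m.re ≤ ε / 2 * (n + 1)) :
    ((∀ (j : ℕ) (x : ℝ), 0 < x →
        GreenQDefinedAt (twoSidedKernelOn 1 m k) Q (iter m k Q j) x) ∧
      (∀ x ∈ Ioo 0 1, GreenQDefinedAt (forwardKernel m k) Q (iter m k Q n) x) ∧
      (∀ x ∈ Ioo 0 1, DifferentiableAt ℝ (trunc m k Q n) x)) ∧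
    (∃ g : ℝ → ℂ, (IsEigensolution m k Q g ∧ AgreesNearZero m g (trunc m k Q n)) ∧
      (∀ h : ℝ → ℂ, IsEigensolution m k Q h → AgreesNearZero m h (trunc m k Q n) →
        EqOn h g (Ioi 0)) ∧
      ∃ r : ℝ → ℂ,
        IsForwardResolvent m k Q (greenQ (forwardKernel m k) Q (iter m k Q n)) r ∧
        (∀ s : ℝ → ℂ,
          IsForwardResolvent m k Q (greenQ (forwardKernel m k) Q (iter m k Q n)) s →
            EqOn s r (Ioo 0 1)) ∧
        ∀ x ∈ Ioo 0 1, g x = trunc m k Q n x + (-1) ^ (n + 1) * r x) ∧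
    (m.re < 1 → ∀ k' : ℂ,
      ∃ g : ℝ → ℂ, (IsEigensolution m k Q g ∧ AgreesNearZero m g (trunc m k' Q n)) ∧
        ∀ h : ℝ → ℂ, IsEigensolution m k Q h → AgreesNearZero m h (trunc m k' Q n) →
          EqOn h g (Ioi 0)) := by
  have hε : 0 ≤ ε := by
    have hprod : 0 ≤ ε / 2 * ((n : ℝ) + 1) := hm.trans hn
    linarith [nonneg_of_mul_nonneg_left hprod (by positivity)]
  have hQ0 := antitone_potentialClass hε hQ
  refine ⟨⟨fun j x hx => greenQDefinedAt_iter hm hm0 hε hQ j hx,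
    fun x hx => greenQDefinedAt_forwardKernel_iter hm hm0 hε hQ hn hx.2.le,
    fun x hx => differentiableAt_trunc hm hm0 hε hQ n hx⟩, ?_, fun hlt k' =>
    existsUnique_eigensolution_agreesNearZero hm hm0 hε hQ hn (.inr hlt)⟩
  obtain ⟨r, hr, hg, hgT⟩ := exists_forwardResolvent_eigensolution (k := k) hm hm0 hε hQ hn
  refine ⟨_, ⟨hg, hgT⟩, fun h hh hhT => eqOn_of_agreesNearZero hm hm0 hQ0 hh hg hhT hgT,
    r, hr, fun s hs => hs.eqOn hr hm hm0 hQ0, fun x hx => ?_⟩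
  rw [extTrunc_eqOn_trunc hm hm0 hε hQ n ⟨hx.1, hx.2.le⟩]

end PerturbedBessel

open PerturbedBessel in
theorem mainTheorem7 (m k : ℂ) (hm : 0 ≤ m.re) (hm0 : m ≠ 0) (hk : 0 ≤ k.re)
    (ε : ℝ) (hε : 0 ≤ ε) (Q : ℝ → ℂ) (hQ : Q ∈ PotentialClass ε)
    (n : ℕ) (hn : m.re ≤ ε / 2 * ((n : ℝ) + 1)) :
    -- the integrals that define the truncated series and the formula for the solution converge,
    -- and the truncated series is differentiable on `]0,1[`
    ((∀ (j : ℕ) (x : ℝ), 0 < x →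
        GreenQDefinedAt (twoSidedKernelOn 1 m k) Q (iter m k Q j) x) ∧
      (∀ x ∈ Set.Ioo (0 : ℝ) 1, GreenQDefinedAt (forwardKernel m k) Q (iter m k Q n) x) ∧
      (∀ x ∈ Set.Ioo (0 : ℝ) 1, DifferentiableAt ℝ (trunc m k Q n) x)) ∧
    -- the solution, its uniqueness and the formula for it
    (∃ g : ℝ → ℂ, (IsEigensolution m k Q g ∧ AgreesNearZero m g (trunc m k Q n)) ∧
      (∀ h : ℝ → ℂ, IsEigensolution m k Q h → AgreesNearZero m h (trunc m k Q n) →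
        Set.EqOn h g (Set.Ioi 0)) ∧
      ∃ r : ℝ → ℂ,
        IsForwardResolvent m k Q (greenQ (forwardKernel m k) Q (iter m k Q n)) r ∧
        (∀ s : ℝ → ℂ,
          IsForwardResolvent m k Q (greenQ (forwardKernel m k) Q (iter m k Q n)) s →
            Set.EqOn s r (Set.Ioo 0 1)) ∧
        ∀ x ∈ Set.Ioo (0 : ℝ) 1, g x = trunc m k Q n x + (-1) ^ (n + 1) * r x) ∧
    -- for `Re m < 1` the parameter of the truncated series may be any other one, in particular `0`
    (m.re < 1 → ∀ k' : ℂ, 0 ≤ k'.re →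
      ∃ g : ℝ → ℂ, (IsEigensolution m k Q g ∧ AgreesNearZero m g (trunc m k' Q n)) ∧
        ∀ h : ℝ → ℂ, IsEigensolution m k Q h → AgreesNearZero m h (trunc m k' Q n) →
          Set.EqOn h g (Set.Ioi 0)) := by
  have hgen := mainTheorem7_general m k hm hm0 ε Q hQ n hn
  exact ⟨hgen.1, hgen.2.1, fun hlt k' _ => hgen.2.2 hlt k'⟩
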